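/- **Theorem.** Let $\kappa,\tau\in\mathbb R$ and let $\mathbb E(\kappa,\tau)$ be given by the model $\mathcal R(\kappa,\tau)$, which is $\mathbb R^3$ if $\kappa\ge 0$ and $\{x^2+y^2<4/(-\kappa)\}\times\mathbb R$ if $\kappa<0$, with the metric $$g=\sigma^2(dx^2+dy^2)+(\sigma\tau(y\,dx-x\,dy)+dz)^2,\qquad \sigma=\frac{4}{4+\kappa(x^2+y^2)}.$$ Let $r>0$, with $r<2/\sqrt{-\kappa}$ if $\kappa<0$, let $\rho=\int_0^r\frac{4}{4+\kappa s^2}\,ds$ be the geodesic radius of the circle $\alpha=\{x^2+y^2=r^2\}$ in the base with metric $\sigma^2(dx^2+dy^2)$, and let $L>0$. If $\kappa>0$ and $\tau>0$, assume moreover $L<8\tau\pi/\kappa$. Let $$\mathsf C_\alpha(L)=\{(x,y,z): x^2+y^2=r^2,\ 0\le z\le L\},\qquad \Pi_c=\{z=c\}.$$ Consider smooth variations $\Sigma_\varepsilon$ of $\Sigma_0=\mathsf C_\alpha(L)$ whose interiors lie in $\{0<z<L\}$ and whose two boundary curves lie in $\Pi_0$ and in $\Pi_L$ respectively. Such a variation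 preserves the volume if the signed volume swept out between $\Sigma_0$ and $\Sigma_\varepsilon$ is zero for all small $\varepsilon$. For a contact angle $\gamma$ let $\mathcal E(\varepsilon)=\mathrm{Area}(\Sigma_\varepsilon)-\cos\gamma\,\mathrm{Area}(\Omega(\varepsilon))$, where $\Omega(\varepsilon)\subset\Pi_0\cup\Pi_L$ is bounded by $\partial\Sigma_\varepsilon$. The surface $\Sigma_0$ is capillary with contact angle $\gamma$ if $\mathcal E'(0)=0$ for all these volume-preserving variations; in that case it is stable in the partitioning problem if $\mathcal E''(0)\ge 0$ for all of them. Then: 1. $\mathsf C_\alpha(L)$ meets $\Pi_0$ and $\Pi_L$ orthogonally. Along its boundary the Robin coefficient $$\mathbf q=\frac{1}{\sin\gamma}\widetilde A(\widetilde\nu,\widetilde\nu)+\frac{\cos\gamma}{\sin\gamma}A(\nu,\nu)$$ vanishes, where $\cos\gamma=\langle N,\widetilde N\rangle$ for unit normals $N$ of the cylinder and $\widetilde N$ of the plane, $A$ is the second fundamental form of the cylinder with respect to $N$, $\widetilde A$ is that of the plane with respect to $-\widetilde N$, and $\nu,\widetilde\nu$ are unit conormals of the boundary in the cylinder and in the plane.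 Hence the Robin condition $\partial u/\partial\nu-\mathbf q u=0$ is the Neumann condition $\partial u/\partial\nu=0$. 2. $\mathsf C_\alpha(L)$ is a capillary surface with contact angle $\pi/2$. 3. If $L>L_0$, where $$L_0=\begin{cases}\frac{2\pi}{-\kappa}\sinh(\rho\sqrt{-\kappa})\sqrt{-\kappa+4\tau^2\tanh^2\left(\frac{\rho\sqrt{-\kappa}}{2}\right)}&\kappa<0,\\ 2\pi\rho\sqrt{1+\tau^2\rho^2}&\kappa=0,\\ \frac{2\pi}{\kappa}\sin(\rho\sqrt{\kappa})\sqrt{\kappa+4\tau^2\tan^2\left(\frac{\rho\sqrt{\kappa}}{2}\right)}&\kappa>0,\end{cases}$$ then $\mathsf C_\alpha(L)$ is not stable in the partitioning problem. -/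

import Mathlib

open scoped ContDiff

noncomputable section

namespace EKT

/-! ### The model `R(κ,τ)` of the homogeneous space `E(κ,τ)` -/

/-- Points and tangent vectors, in the coordinates `(x, y, z) = (p 0, p 1, p 2)`. -/
abbrev E3 : Type := Fin 3 → ℝ

/-- The underlying set of the model: `ℝ³` if `κ ≥ 0`, and `𝔻(2/√(-κ)) × ℝ` if `κ < 0`. -/
def model (κ : ℝ) : Set E3 :=
  {p | κ < 0 → (p 0) ^ 2 + (p 1) ^ 2 < (2 / Real.sqrt (-κ)) ^ 2}

/-- The conformal factor `σ = 4 / (4 + κ (x² + y²))`. -/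
def sigma (κ : ℝ) (p : E3) : ℝ := 4 / (4 + κ * ((p 0) ^ 2 + (p 1) ^ 2))

/-- The metric `g = σ² (dx² + dy²) + (σ τ (y dx - x dy) + dz)²` at `p`, as a bilinear form. -/
def metric (κ τ : ℝ) (p v w : E3) : ℝ :=
  (sigma κ p) ^ 2 * (v 0 * w 0 + v 1 * w 1)
    + (sigma κ p * τ * (p 1 * v 0 - p 0 * v 1) + v 2)
      * (sigma κ p * τ * (p 1 * w 0 - p 0 * w 1) + w 2)

/-- The Riemannian volume density `√(det (g_ij))` in the coordinates `(x, y, z)`. -/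
def volDensity (κ τ : ℝ) (p : E3) : ℝ :=
  Real.sqrt (Matrix.det (Matrix.of fun i j : Fin 3 =>
    metric κ τ p (Pi.single i 1) (Pi.single j 1)))

/-- The Levi-Civita connection of `g`: the number `g(∇_u v, w)` at `p` for the vector fields with
constant coordinates `u`, `v`, `w` (Koszul formula; the Christoffel symbols of the first kind). -/
def christoffel (κ τ : ℝ) (p u v w : E3) : ℝ :=
  (1 / 2) * (fderiv ℝ (fun q => metric κ τ q v w) p u
    + fderiv ℝ (fun q => metric κ τ q u w) p v
    - fderiv ℝ (fun q => metric κ τ q u v) p w)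

/-! ### Circular cylinders and horizontal planes -/

/-- The Riemannian submersion `π` onto the base. -/
def proj (p : E3) : ℝ × ℝ := (p 0, p 1)

/-- The circle of coordinate radius `r` about the origin of the base. -/
def circle (r : ℝ) : Set (ℝ × ℝ) := {q | q.1 ^ 2 + q.2 ^ 2 = r ^ 2}

/-- The truncated circular cylinder of length `L` over `circle r`. -/
def truncatedCylinder (r L : ℝ) : Set E3 := {p | p ∈ proj ⁻¹' circle r ∧ 0 ≤ p 2 ∧ p 2 ≤ L}

/-- The parametrization `(θ, t) ↦ (r cos θ, r sin θ, t)` of the cylinder, `2π`-periodic in `θ`. -/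
def cylinder (r : ℝ) (θ t : ℝ) : E3 := ![r * Real.cos θ, r * Real.sin θ, t]

/-- The plane `z = c`, parametrized by `(x, y) ↦ (x, y, c)`. -/
def plane (c : ℝ) (x y : ℝ) : E3 := ![x, y, c]

theorem image_cylinder (r L : ℝ) (hr : 0 < r) :
    (fun q : ℝ × ℝ => cylinder r q.1 q.2) '' (Set.univ ×ˢ Set.Icc 0 L) =
      truncatedCylinder r L := by
  ext p
  constructor
  · rintro ⟨⟨θ, t⟩, ⟨-, ht⟩, rfl⟩
    refine ⟨?_, ?_, ?_⟩
    · change (r * Real.cos θ) ^ 2 + (r * Real.sin θ) ^ 2 = r ^ 2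
      have h := Real.sin_sq_add_cos_sq θ
      linear_combination r ^ 2 * h
    · exact ht.1
    · exact ht.2
  · rintro ⟨hc, h0, hL⟩
    have hc' : (p 0) ^ 2 + (p 1) ^ 2 = r ^ 2 := hc
    have hn : ‖(⟨p 0, p 1⟩ : ℂ)‖ = r := by
      rw [Complex.norm_def, Complex.normSq_mk, ← sq, ← sq, hc', Real.sqrt_sq hr.le]
    refine ⟨(Complex.arg ⟨p 0, p 1⟩, p 2), ⟨Set.mem_univ _, h0, hL⟩, ?_⟩
    have h1 := Complex.norm_mul_cos_arg (⟨p 0, p 1⟩ : ℂ)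
    have h2 := Complex.norm_mul_sin_arg (⟨p 0, p 1⟩ : ℂ)
    rw [hn] at h1 h2
    funext i
    fin_cases i
    · exact h1
    · exact h2
    · rfl

/-- The radius `ρ` of `circle r` in the space form with metric `σ² (dx² + dy²)`: the length of
the radial geodesic that joins the centre to the circle. -/
def circleRadius (κ r : ℝ) : ℝ := ∫ s in (0 : ℝ)..r, sigma κ ![s, 0, 0]

/-- The critical length `L₀` as a function of `κ`, `τ` and the radius `ρ`. -/
def criticalLength (κ τ ρ : ℝ) : ℝ :=
  if κ < 0 then
    2 * Real.pi / (-κ) * Real.sinh (ρ * Real.sqrt (-κ))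
      * Real.sqrt (-κ + 4 * τ ^ 2 * Real.tanh (ρ * Real.sqrt (-κ) / 2) ^ 2)
  else if κ = 0 then
    2 * Real.pi * ρ * Real.sqrt (1 + τ ^ 2 * ρ ^ 2)
  else
    2 * Real.pi / κ * Real.sin (ρ * Real.sqrt κ)
      * Real.sqrt (κ + 4 * τ ^ 2 * Real.tan (ρ * Real.sqrt κ / 2) ^ 2)

/-! ### Geometry of parametrized surfaces -/

/-- First partial derivative of a parametrized surface. -/
def d₁ (X : ℝ → ℝ → E3) (a b : ℝ) : E3 := deriv (fun a' => X a' b) a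

/-- Second partial derivative of a parametrized surface. -/
def d₂ (X : ℝ → ℝ → E3) (a b : ℝ) : E3 := deriv (fun b' => X a b') b

/-- The tangent vector at `X a b` with coordinates `ξ` in the basis `X_a, X_b`. -/
def tangent (X : ℝ → ℝ → E3) (a b : ℝ) (ξ : ℝ × ℝ) : E3 := ξ.1 • d₁ X a b + ξ.2 • d₂ X a b

/-- `N` is a unit normal vector of the surface at `X a b`. -/
def IsUnitNormal (κ τ : ℝ) (X : ℝ → ℝ → E3) (a b : ℝ) (N : E3) : Prop :=
  metric κ τ (X a b) N N = 1 ∧ ∀ ξ : ℝ × ℝ, metric κ τ (X a b) N (tangent X a b ξ) = 0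

/-- `ξ` is the coordinate vector of a unit tangent vector of the surface at `X a b` that is
orthogonal to `e`; for `e` tangent to a boundary curve this is a unit conormal of that curve. -/
def IsUnitConormal (κ τ : ℝ) (X : ℝ → ℝ → E3) (a b : ℝ) (e : E3) (ξ : ℝ × ℝ) : Prop :=
  metric κ τ (X a b) (tangent X a b ξ) (tangent X a b ξ) = 1 ∧
    metric κ τ (X a b) (tangent X a b ξ) e = 0

/-- The second fundamental form `A(ξ, η) = g(∇_ξ η, N)` of the surface at `X a b` with respect to
the unit normal `N`, where `∇_{X_i} X_j = X_ij + Γ(X_i, X_j)`. -/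
def secondFF (κ τ : ℝ) (X : ℝ → ℝ → E3) (a b : ℝ) (N : E3) (ξ η : ℝ × ℝ) : ℝ :=
  metric κ τ (X a b)
      ((ξ.1 * η.1) • d₁ (d₁ X) a b + (ξ.1 * η.2 + ξ.2 * η.1) • d₁ (d₂ X) a b
        + (ξ.2 * η.2) • d₂ (d₂ X) a b) N
    + christoffel κ τ (X a b) (tangent X a b ξ) (tangent X a b η) N

/-- The Robin coefficient `q = Ã(ν̃, ν̃) / sin γ + (cos γ / sin γ) A(ν, ν)` at a common point
`X a b = Y c d` of the surface `X` with unit normal `N` and unit conormal `ξ`, and of the support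
surface `Y` with unit normal `M` and unit conormal `η`; `γ` is the angle between `N` and `M`, and
`Ã` is taken with respect to `-M`. The conormals enter quadratically, so that their
orientation does not matter. -/
def robinCoeff (κ τ : ℝ) (X : ℝ → ℝ → E3) (a b : ℝ) (N : E3) (ξ : ℝ × ℝ)
    (Y : ℝ → ℝ → E3) (c d : ℝ) (M : E3) (η : ℝ × ℝ) : ℝ :=
  (1 / Real.sin (Real.arccos (metric κ τ (X a b) N M))) * secondFF κ τ Y c d (-M) η η
    + (Real.cos (Real.arccos (metric κ τ (X a b) N M))
        / Real.sin (Real.arccos (metric κ τ (X a b) N M))) * secondFF κ τ X a b N ξ ξ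

/-- The derivative of a function `u` on the surface in the direction with coordinates `ξ`. -/
def dirDeriv (u : ℝ → ℝ → ℝ) (a b : ℝ) (ξ : ℝ × ℝ) : ℝ :=
  ξ.1 * deriv (fun a' => u a' b) a + ξ.2 * deriv (fun b' => u a b') b

/-! ### The partitioning problem in the slab `0 < z < L` with support planes `z = 0`, `z = L` -/

/-- Area of an annulus parametrized by `X` on `[0, 2π] × [0, L]`. -/
def area (κ τ L : ℝ) (X : ℝ → ℝ → E3) : ℝ :=
  ∫ θ in (0 : ℝ)..(2 * Real.pi), ∫ t in (0 : ℝ)..L,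
    Real.sqrt (metric κ τ (X θ t) (d₁ X θ t) (d₁ X θ t)
        * metric κ τ (X θ t) (d₂ X θ t) (d₂ X θ t)
      - (metric κ τ (X θ t) (d₁ X θ t) (d₂ X θ t)) ^ 2)

/-- An admissible variation of the annulus `X`: a smooth family `map ε` of annuli, with
`map 0 = X`, whose interiors stay in the open slab and whose boundary curves stay in the planes
`z = 0` and `z = L`. The maps are taken as restrictions of smooth maps on `ℝ³`; only the values
for `|ε| < δ` and `0 ≤ t ≤ L` matter. -/
structure AdmissibleVariation (κ L : ℝ) (X : ℝ → ℝ → E3) where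
  /-- The family of annuli, as a function of `ε`, `θ`, `t`. -/
  map : ℝ → ℝ → ℝ → E3
  /-- Half-width of the parameter interval. -/
  δ : ℝ
  δ_pos : 0 < δ
  smooth : ContDiff ℝ ∞ (fun q : ℝ × ℝ × ℝ => map q.1 q.2.1 q.2.2)
  periodic : ∀ ε θ t, map ε (θ + 2 * Real.pi) t = map ε θ t
  map_zero : ∀ θ, ∀ t ∈ Set.Icc 0 L, map 0 θ t = X θ t
  mem_model : ∀ ε, |ε| < δ → ∀ θ, ∀ t ∈ Set.Icc 0 L, map ε θ t ∈ model κ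
  lower : ∀ ε, |ε| < δ → ∀ θ, map ε θ 0 2 = 0
  upper : ∀ ε, |ε| < δ → ∀ θ, map ε θ L 2 = L
  interior : ∀ ε, |ε| < δ → ∀ θ, ∀ t ∈ Set.Ioo 0 L, 0 < map ε θ t 2 ∧ map ε θ t 2 < L

/-- The velocity `∂Φ/∂ε` of a family of annuli. -/
def velocity (Φ : ℝ → ℝ → ℝ → E3) (ε θ t : ℝ) : E3 := deriv (fun ε' => Φ ε' θ t) ε

/-- The (signed) volume `∫_{[0,ε] × Σ} Φ^* dvol` swept out by the family from `0` to `ε`, that is,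
the change of the volume enclosed by the annulus and the support planes. -/
def volumeChange (κ τ L : ℝ) (Φ : ℝ → ℝ → ℝ → E3) (ε : ℝ) : ℝ :=
  ∫ e in (0 : ℝ)..ε, ∫ θ in (0 : ℝ)..(2 * Real.pi), ∫ t in (0 : ℝ)..L,
    volDensity κ τ (Φ e θ t)
      * Matrix.det (Matrix.of ![velocity Φ e θ t, d₁ (Φ e) θ t, d₂ (Φ e) θ t])

/-- The variation preserves the volume. -/
def AdmissibleVariation.IsVolumePreserving {κ L : ℝ} {X : ℝ → ℝ → E3} (τ : ℝ)
    (V : AdmissibleVariation κ L X) : Prop :=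
  ∀ ε, |ε| < V.δ → volumeChange κ τ L V.map ε = 0

/-- The area density of the planes `z = c` in the coordinates `(x, y)`. -/
def planeDensity (κ τ : ℝ) (p : E3) : ℝ :=
  Real.sqrt (metric κ τ p ![1, 0, 0] ![1, 0, 0] * metric κ τ p ![0, 1, 0] ![0, 1, 0]
    - (metric κ τ p ![1, 0, 0] ![0, 1, 0]) ^ 2)

/-- The (signed) area of the support planes swept out by the boundary curve `t = c` of the family
from `0` to `ε`. -/
def boundaryAreaChange (κ τ c : ℝ) (Φ : ℝ → ℝ → ℝ → E3) (ε : ℝ) : ℝ :=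
  ∫ e in (0 : ℝ)..ε, ∫ θ in (0 : ℝ)..(2 * Real.pi),
    planeDensity κ τ (Φ e θ c)
      * (velocity Φ e θ c 0 * d₁ (Φ e) θ c 1 - velocity Φ e θ c 1 * d₁ (Φ e) θ c 0)

/-- The energy `Area(Σ_ε) - cos γ · Area(Ω(ε))`, normalized by dropping the constant
`cos γ · Area(Ω(0))`; here `Ω(ε)` is the part of the planes `z = 0` and `z = L` that is enclosed
by the boundary curves of `Σ_ε`. -/
def energy (κ τ L γ : ℝ) (Φ : ℝ → ℝ → ℝ → E3) (ε : ℝ) : ℝ :=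
  area κ τ L (Φ ε)
    - Real.cos γ * (boundaryAreaChange κ τ 0 Φ ε + boundaryAreaChange κ τ L Φ ε)

/-- The annulus `X` is a capillary surface with contact angle `γ`: a critical point of the energy
for all volume-preserving admissible variations. -/
def IsCapillary (κ τ L γ : ℝ) (X : ℝ → ℝ → E3) : Prop :=
  ∀ V : AdmissibleVariation κ L X, V.IsVolumePreserving τ →
    HasDerivAt (energy κ τ L γ V.map) 0 0

/-- The annulus `X` is stable in the partitioning problem: the second derivative of the energy is
nonnegative for all volume-preserving admissible variations. -/
def IsStable (κ τ L γ : ℝ) (X : ℝ → ℝ → E3) : Prop :=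
  ∀ V : AdmissibleVariation κ L X, V.IsVolumePreserving τ →
    0 ≤ iteratedDeriv 2 (energy κ τ L γ V.map) 0

end EKT

end

noncomputable section

namespace EKT

/-! Write σ for the conformal factor on the circle. The metric has the orthonormal coframe σ dx, σ
dy, ω with ω = στ(y dx − x dy) + dz, and ω vanishes on radial vectors. This explains the
orthogonality: the normal of the cylinder is radial, while a normal of a plane z = c has no radial
component. Hence γ = π/2, and the Robin coefficient reduces to the curvature of the plane in the
radial direction. It is zero because the radial line is a geodesic, the axis of the isometry (x, y,
z) ↦ (x, −y, −z) when it is the x-axis (`christoffel_radial`).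

For γ = π/2 the energy is the area. To first order the area element of the cylinder changes by a
constant times the radial velocity, plus the θ-derivative of the angular velocity and the
t-derivative of the vertical velocity, with constant factors (`fderiv_areaSq_zero`). The last two
integrate to zero, by periodicity and because the boundary stays in the planes. The volume
constraint, differentiated once, says that the radial velocity has integral zero.

Instability is shown by one explicit family of surfaces of revolution. Let 2πw(t) be the base area
enclosed by the circle at height t. Then dw = σ²R dR for the coordinate radius R, the enclosed
volume is 2π∫w dt, and the squared area element is w(2 − κw) + P(w) w_t² with P = 1 + τ²R². The
choice w = w₀ + η sin ε cos(πt/L) keeps the volume exactly, since the cosine has mean zero; it is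
the first nonconstant Neumann mode. With G = w₀(2 − κw₀) = (σr)², the second derivative of the area
is a positive multiple of P(w₀)(π/L)² − 1/G (`areaSecond_zero`, `iteratedDeriv_two_integral_neg`).
It is negative as soon as L > πσr√(1 + τ²r²). By `criticalLength_circleRadius` this bound is L₀/2,
so L > L₀ is more than enough. -/

/-- The conformal factor at coordinate distance `r` from the axis. -/
def conf (κ r : ℝ) : ℝ := 4 / (4 + κ * r ^ 2)

/-! ### Geodesic radius of the circle and the critical length -/

theorem denom_pos_of_lt {κ x : ℝ} (h : κ < 0 → x < (2 / Real.sqrt (-κ)) ^ 2) (hx : 0 ≤ x) :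
    0 < 4 + κ * x := by
  by_cases hκ : κ < 0
  · have h1 := h hκ
    have hk : 0 < -κ := by linarith
    rw [div_pow, Real.sq_sqrt hk.le, lt_div_iff₀ hk] at h1
    nlinarith
  · push Not at hκ
    positivity

theorem denom_pos {κ r : ℝ} (hr : 0 < r) (h : κ < 0 → r < 2 / Real.sqrt (-κ)) :
    0 < 4 + κ * r ^ 2 :=
  denom_pos_of_lt (fun hκ => pow_lt_pow_left₀ (h hκ) hr.le two_ne_zero) (sq_nonneg r)

/-- The antiderivative is only required on [0, r]: for κ < 0 the integrand has a pole at the edge of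
the disk. -/
theorem circleRadius_eq_sub {κ r : ℝ} (hr : 0 < r) (h : 0 < 4 + κ * r ^ 2) (F : ℝ → ℝ)
    (hF : ∀ s, 0 ≤ s → s ≤ r → HasDerivAt F (4 / (4 + κ * s ^ 2)) s) :
    circleRadius κ r = F r - F 0 := by
  have hpos : ∀ s ∈ Set.uIcc 0 r, 0 < 4 + κ * s ^ 2 := by
    intro s hs
    rw [Set.uIcc_of_le hr.le] at hs
    have h1 : s ^ 2 ≤ r ^ 2 := pow_le_pow_left₀ hs.1 hs.2 2
    rcases le_or_gt 0 κ with hκ | hκ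
    · positivity
    · nlinarith
  have hcongr : circleRadius κ r = ∫ s in (0 : ℝ)..r, 4 / (4 + κ * s ^ 2) := by
    simp [circleRadius, sigma]
  rw [hcongr]
  refine intervalIntegral.integral_eq_sub_of_hasDerivAt (fun s hs => ?_) ?_
  · rw [Set.uIcc_of_le hr.le] at hs
    exact hF s hs.1 hs.2
  · refine ContinuousOn.intervalIntegrable ?_
    exact continuousOn_const.div (by fun_prop) fun s hs => (hpos s hs).ne'

theorem circleRadius_of_neg {κ r : ℝ} (hr : 0 < r) (hκ : κ < 0) (h : 0 < 4 + κ * r ^ 2) :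
    circleRadius κ r * Real.sqrt (-κ) / 2 = Real.artanh (Real.sqrt (-κ) * r / 2) := by
  have hk : 0 < Real.sqrt (-κ) := Real.sqrt_pos.2 (by linarith)
  have hk2 : Real.sqrt (-κ) ^ 2 = -κ := Real.sq_sqrt (by linarith)
  generalize Real.sqrt (-κ) = k at *
  obtain rfl : κ = -k ^ 2 := by linarith
  have hkr : k * r < 2 := by nlinarith [mul_pos hk hr]
  -- Partial fractions: 4/(4 − k²s²) = 1/(2 + ks) + 1/(2 − ks).
  rw [circleRadius_eq_sub hr h (fun s => (Real.log (2 + k * s) - Real.log (2 - k * s)) / k)]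
  · have h1 : 0 < k * r := mul_pos hk hr
    rw [Real.artanh_eq_half_log ⟨by linarith, by linarith⟩]
    have h2 : (1 + k * r / 2) / (1 - k * r / 2) = (2 + k * r) / (2 - k * r) := by
      have : 2 - k * r ≠ 0 := by linarith
      have : 1 - k * r / 2 ≠ 0 := by linarith
      field_simp
    rw [h2, Real.log_div (by linarith) (by linarith)]
    have hk' := hk.ne'
    simp only [mul_zero, zero_div, add_zero, sub_zero, sub_self]
    field_simp
  · intro s hs hsr
    have h1 : k * s ≤ k * r := mul_le_mul_of_nonneg_left hsr hk.le
    have h0 : 0 ≤ k * s := mul_nonneg hk.le hs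
    have hp : 2 + k * s ≠ 0 := by linarith
    have hm : 2 - k * s ≠ 0 := by linarith
    have hpm : 4 + -k ^ 2 * s ^ 2 = (2 + k * s) * (2 - k * s) := by ring
    have e1 : HasDerivAt (fun s : ℝ => 2 + k * s) k s := by
      simpa using ((hasDerivAt_id s).const_mul k).const_add 2
    have e2 : HasDerivAt (fun s : ℝ => 2 - k * s) (-k) s := by
      simpa using ((hasDerivAt_id s).const_mul k).const_sub 2
    refine (((e1.log hp).sub (e2.log hm)).div_const k).congr_deriv ?_
    have hk' := hk.ne'
    rw [hpm]
    field_simp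
    ring

theorem circleRadius_of_pos {κ r : ℝ} (hr : 0 < r) (hκ : 0 < κ) :
    circleRadius κ r * Real.sqrt κ / 2 = Real.arctan (Real.sqrt κ * r / 2) := by
  have hk : 0 < Real.sqrt κ := Real.sqrt_pos.2 hκ
  have hk2 : Real.sqrt κ ^ 2 = κ := Real.sq_sqrt hκ.le
  generalize Real.sqrt κ = k at *
  obtain rfl : κ = k ^ 2 := hk2.symm
  rw [circleRadius_eq_sub hr (by positivity) (fun s => 2 * Real.arctan (k * s / 2) / k)]
  · field_simp
    simp
  · intro s hs hsr
    have e1 : HasDerivAt (fun s : ℝ => k * s / 2) (k / 2) s := by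
      simpa using ((hasDerivAt_id s).const_mul k).div_const 2
    refine (((e1.arctan).const_mul 2).div_const k).congr_deriv ?_
    field_simp
    ring

theorem circleRadius_zero {r : ℝ} (hr : 0 < r) : circleRadius 0 r = r := by
  rw [circleRadius_eq_sub hr (by norm_num) id]
  · simp
  · intro s _ _
    simpa using hasDerivAt_id s

/-- The critical length is the length of the closed curves `z = const` of the cylinder. -/
theorem criticalLength_circleRadius {κ τ r : ℝ} (hr : 0 < r) (h : 0 < 4 + κ * r ^ 2) :
    criticalLength κ τ (circleRadius κ r) =
      2 * Real.pi * (conf κ r * r) * Real.sqrt (1 + τ ^ 2 * r ^ 2) := by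
  unfold criticalLength conf
  split_ifs with h1 h2
  · have hρ := circleRadius_of_neg hr h1 h
    have hk : 0 < Real.sqrt (-κ) := Real.sqrt_pos.2 (by linarith)
    have hk2 : Real.sqrt (-κ) ^ 2 = -κ := Real.sq_sqrt (by linarith)
    -- The half argument is artanh(kr/2), so the double-angle formula makes the hyperbolic functions
    -- algebraic in r. The case κ > 0 is the same with arctan.
    have e : circleRadius κ r * Real.sqrt (-κ) = 2 * (circleRadius κ r * Real.sqrt (-κ) / 2) := by
      ring
    rw [e, mul_div_cancel_left₀ _ two_ne_zero, hρ, Real.sinh_two_mul]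
    generalize Real.sqrt (-κ) = k at *
    obtain rfl : κ = -k ^ 2 := by linarith
    have h0 : 0 < k * r := mul_pos hk hr
    have hkr : k * r < 2 := by nlinarith
    have hm : k * r / 2 ∈ Set.Ioo (-1 : ℝ) 1 := ⟨by linarith, by linarith⟩
    rw [Real.sinh_artanh hm, Real.cosh_artanh hm, Real.tanh_artanh hm]
    have hp : 0 < 1 - (k * r / 2) ^ 2 := by nlinarith
    have hs := Real.sq_sqrt hp.le
    have hs0 := (Real.sqrt_pos.2 hp).ne'
    have e2 : -(-k ^ 2) + 4 * τ ^ 2 * (k * r / 2) ^ 2 = k ^ 2 * (1 + τ ^ 2 * r ^ 2) := by ring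
    rw [e2, Real.sqrt_mul (sq_nonneg k), Real.sqrt_sq hk.le]
    have e3 : 2 * (k * r / 2 / Real.sqrt (1 - (k * r / 2) ^ 2)) *
        (1 / Real.sqrt (1 - (k * r / 2) ^ 2)) = k * (4 / (4 + -k ^ 2 * r ^ 2) * r) := by
      have e4 : 2 * (k * r / 2 / Real.sqrt (1 - (k * r / 2) ^ 2)) *
        (1 / Real.sqrt (1 - (k * r / 2) ^ 2)) =
          k * r / (Real.sqrt (1 - (k * r / 2) ^ 2)) ^ 2 := by field_simp
      rw [e4, hs]
      have h' := h.ne'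
      have e5 : 1 - (k * r / 2) ^ 2 = (4 + -k ^ 2 * r ^ 2) / 4 := by ring
      rw [e5]
      field_simp
    rw [e3]
    field_simp
  · subst h2
    rw [circleRadius_zero hr]
    norm_num
  · have hκ : 0 < κ := lt_of_le_of_ne (not_lt.1 h1) (Ne.symm h2)
    have hρ := circleRadius_of_pos hr hκ
    have hk : 0 < Real.sqrt κ := Real.sqrt_pos.2 hκ
    have hk2 : Real.sqrt κ ^ 2 = κ := Real.sq_sqrt hκ.le
    have e : circleRadius κ r * Real.sqrt κ = 2 * (circleRadius κ r * Real.sqrt κ / 2) := by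
      ring
    rw [e, mul_div_cancel_left₀ _ two_ne_zero, hρ, Real.sin_two_mul, Real.sin_arctan,
      Real.cos_arctan, Real.tan_arctan]
    generalize Real.sqrt κ = k at *
    obtain rfl : κ = k ^ 2 := hk2.symm
    have hp : 0 < 1 + (k * r / 2) ^ 2 := by positivity
    have hs := Real.sq_sqrt hp.le
    have hs0 := (Real.sqrt_pos.2 hp).ne'
    have e2 : k ^ 2 + 4 * τ ^ 2 * (k * r / 2) ^ 2 = k ^ 2 * (1 + τ ^ 2 * r ^ 2) := by ring
    rw [e2, Real.sqrt_mul (sq_nonneg k), Real.sqrt_sq hk.le]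
    have e3 : 2 * (k * r / 2 / Real.sqrt (1 + (k * r / 2) ^ 2)) *
        (1 / Real.sqrt (1 + (k * r / 2) ^ 2)) = k * (4 / (4 + k ^ 2 * r ^ 2) * r) := by
      have e4 : 2 * (k * r / 2 / Real.sqrt (1 + (k * r / 2) ^ 2)) *
        (1 / Real.sqrt (1 + (k * r / 2) ^ 2)) =
          k * r / (Real.sqrt (1 + (k * r / 2) ^ 2)) ^ 2 := by field_simp
      rw [e4, hs, div_eq_iff hp.ne']
      field_simp
      ring
    rw [e3]
    field_simp

/-! ### Normals, conormals and the Robin coefficient -/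

open Real in
theorem hasDerivAt_cylinder_left (r θ t : ℝ) :
    HasDerivAt (fun θ => cylinder r θ t) ![-(r * sin θ), r * cos θ, 0] θ := by
  rw [hasDerivAt_pi]
  intro i
  fin_cases i
  · simpa [cylinder] using (hasDerivAt_cos θ).const_mul r
  · simpa [cylinder] using (hasDerivAt_sin θ).const_mul r
  · simpa [cylinder] using hasDerivAt_const θ t

theorem hasDerivAt_cylinder_right (r θ t : ℝ) :
    HasDerivAt (fun t => cylinder r θ t) ![0, 0, 1] t := by
  rw [hasDerivAt_pi]
  intro i
  fin_cases i
  · simpa [cylinder] using hasDerivAt_const t (r * Real.cos θ)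
  · simpa [cylinder] using hasDerivAt_const t (r * Real.sin θ)
  · simpa [cylinder] using hasDerivAt_id' t

theorem d₁_cylinder (r θ t : ℝ) :
    d₁ (cylinder r) θ t = ![-(r * Real.sin θ), r * Real.cos θ, 0] :=
  (hasDerivAt_cylinder_left r θ t).deriv

theorem d₂_cylinder (r θ t : ℝ) : d₂ (cylinder r) θ t = ![0, 0, 1] :=
  (hasDerivAt_cylinder_right r θ t).deriv

theorem d₁_plane (c x y : ℝ) : d₁ (plane c) x y = ![1, 0, 0] := by
  refine HasDerivAt.deriv ?_
  rw [hasDerivAt_pi]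
  intro i
  fin_cases i
  · simpa [plane] using hasDerivAt_id' x
  · simpa [plane] using hasDerivAt_const x y
  · simpa [plane] using hasDerivAt_const x c

theorem d₂_plane (c x y : ℝ) : d₂ (plane c) x y = ![0, 1, 0] := by
  refine HasDerivAt.deriv ?_
  rw [hasDerivAt_pi]
  intro i
  fin_cases i
  · simpa [plane] using hasDerivAt_const y x
  · simpa [plane] using hasDerivAt_id' y
  · simpa [plane] using hasDerivAt_const y c

theorem tangent_plane (c x y : ℝ) (ξ : ℝ × ℝ) : tangent (plane c) x y ξ = ![ξ.1, ξ.2, 0] := by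
  simp only [tangent, d₁_plane, d₂_plane]
  ext i
  fin_cases i <;> simp

theorem secondFF_plane (κ τ c x y : ℝ) (N : E3) (ξ : ℝ × ℝ) :
    secondFF κ τ (plane c) x y N ξ ξ =
      christoffel κ τ ![x, y, c] ![ξ.1, ξ.2, 0] ![ξ.1, ξ.2, 0] N := by
  have h11 : d₁ (d₁ (plane c)) x y = 0 := by
    change deriv (fun a => d₁ (plane c) a y) x = 0
    simp [d₁_plane]
  have h12 : d₁ (d₂ (plane c)) x y = 0 := by
    change deriv (fun a => d₂ (plane c) a y) x = 0
    simp [d₂_plane]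
  have h22 : d₂ (d₂ (plane c)) x y = 0 := by
    change deriv (fun a => d₂ (plane c) x a) y = 0
    simp [d₂_plane]
  simp only [secondFF, h11, h12, h22, tangent_plane, smul_zero, add_zero]
  simp [metric, plane]

theorem differentiableAt_metric {κ p} (τ : ℝ) (v w : E3)
    (hp : 4 + κ * ((p 0) ^ 2 + (p 1) ^ 2) ≠ 0) :
    DifferentiableAt ℝ (fun q : E3 => metric κ τ q v w) p := by
  unfold metric sigma
  have hd : DifferentiableAt ℝ (fun q : E3 => 4 / (4 + κ * ((q 0) ^ 2 + (q 1) ^ 2))) p :=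
    by
    simp only [div_eq_mul_inv]
    fun_prop (disch := exact hp)
  fun_prop

theorem fderiv_metric {κ p} (τ : ℝ) (u v w : E3)
    (hp : 4 + κ * ((p 0) ^ 2 + (p 1) ^ 2) ≠ 0) :
    fderiv ℝ (fun q : E3 => metric κ τ q v w) p u =
      deriv (fun h : ℝ => metric κ τ (p + h • u) v w) 0 := by
  rw [← (differentiableAt_metric τ v w hp).lineDeriv_eq_fderiv]
  rfl

/-- The radial lines of the planes `z = c` have no normal curvature. -/
theorem christoffel_radial {κ r : ℝ} (h : 0 < 4 + κ * r ^ 2) (τ θ c α β m : ℝ) :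
    christoffel κ τ ![r * Real.cos θ, r * Real.sin θ, c]
      ![α * Real.cos θ, α * Real.sin θ, 0] ![α * Real.cos θ, α * Real.sin θ, 0]
      ![-(β * Real.sin θ), β * Real.cos θ, m] = 0 := by
  have hcs := Real.sin_sq_add_cos_sq θ
  have hp : 4 + κ * ((![r * Real.cos θ, r * Real.sin θ, c] : E3) 0 ^ 2 +
      (![r * Real.cos θ, r * Real.sin θ, c] : E3) 1 ^ 2) ≠ 0 := by
    have : 4 + κ * ((![r * Real.cos θ, r * Real.sin θ, c] : E3) 0 ^ 2 +
      (![r * Real.cos θ, r * Real.sin θ, c] : E3) 1 ^ 2) = 4 + κ * r ^ 2 := by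
      simp only [Matrix.cons_val_zero, Matrix.cons_val_one]
      linear_combination (κ * r ^ 2) * hcs
    rw [this]; exact h.ne'
  unfold christoffel
  simp only [fderiv_metric τ _ _ _ hp]
  have h1 : (fun h : ℝ => metric κ τ (![r * Real.cos θ, r * Real.sin θ, c] +
      h • ![α * Real.cos θ, α * Real.sin θ, 0]) ![α * Real.cos θ, α * Real.sin θ, 0]
      ![-(β * Real.sin θ), β * Real.cos θ, m]) = fun _ => 0 := by
    funext h
    simp [metric]
    ring
  -- The squared length of the radial vector is even in the displacement h, as the symmetry about
  -- the radial line predicts. Its derivative at h = 0 therefore vanishes, by the chain rule through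
  -- h².
  have h2 : (fun h : ℝ => metric κ τ (![r * Real.cos θ, r * Real.sin θ, c] +
      h • ![-(β * Real.sin θ), β * Real.cos θ, m]) ![α * Real.cos θ, α * Real.sin θ, 0]
      ![α * Real.cos θ, α * Real.sin θ, 0]) =
      (fun u : ℝ => (4 / (4 + κ * (r ^ 2 + β ^ 2 * u))) ^ 2 * α ^ 2 *
        (1 + τ ^ 2 * β ^ 2 * u)) ∘ fun h : ℝ => h ^ 2 := by
    funext h
    have e1 : sigma κ (![r * Real.cos θ, r * Real.sin θ, c] +
      h • ![-(β * Real.sin θ), β * Real.cos θ, m]) = 4 / (4 + κ * (r ^ 2 + β ^ 2 * h ^ 2)) := by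
      unfold sigma
      congr 3
      simp
      linear_combination (r ^ 2 + β ^ 2 * h ^ 2) * hcs
    simp only [metric, e1, Function.comp]
    generalize 4 / (4 + κ * (r ^ 2 + β ^ 2 * h ^ 2)) = s
    simp
    have e2 : (r * Real.sin θ + h * (β * Real.cos θ)) * (α * Real.cos θ) -
        (r * Real.cos θ + -(h * (β * Real.sin θ))) * (α * Real.sin θ) = h * β * α := by
      linear_combination h * β * α * hcs
    rw [e2]
    linear_combination s ^ 2 * α ^ 2 * hcs
  have h3 : deriv ((fun u : ℝ => (4 / (4 + κ * (r ^ 2 + β ^ 2 * u))) ^ 2 * α ^ 2 *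
        (1 + τ ^ 2 * β ^ 2 * u)) ∘ fun h : ℝ => h ^ 2) 0 = 0 := by
    have hd : DifferentiableAt ℝ (fun u : ℝ => (4 / (4 + κ * (r ^ 2 + β ^ 2 * u))) ^ 2 * α ^ 2 *
        (1 + τ ^ 2 * β ^ 2 * u)) ((0 : ℝ) ^ 2) := by
      have : DifferentiableAt ℝ (fun u : ℝ => 4 / (4 + κ * (r ^ 2 + β ^ 2 * u))) ((0 : ℝ) ^ 2) :=
        DifferentiableAt.fun_div (by fun_prop) (by fun_prop) (by simpa using h.ne')
      fun_prop
    have hq : HasDerivAt (fun h : ℝ => h ^ 2) 0 0 := by simpa using hasDerivAt_pow 2 (0 : ℝ)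
    simpa using (HasDerivAt.comp (h := fun h : ℝ => h ^ 2) 0 hd.hasDerivAt hq).deriv
  rw [h1, h2, h3]
  simp

theorem sigma_cylinder (κ r θ t : ℝ) : sigma κ (cylinder r θ t) = conf κ r := by
  unfold sigma conf
  congr 3
  simp [cylinder]
  linear_combination r ^ 2 * Real.sin_sq_add_cos_sq θ

/-- Orthogonality to the fibre says that ω(N) = 0. Orthogonality to the circle then leaves only the
radial direction, on which ω imposes no vertical part. -/
theorem unitNormal_cylinder {κ τ r : ℝ} (hr : 0 < r) (h : 0 < 4 + κ * r ^ 2) {θ t : ℝ} {N : E3}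
    (hN : IsUnitNormal κ τ (cylinder r) θ t N) :
    N 1 * Real.cos θ - N 0 * Real.sin θ = 0 ∧ N 2 = 0 := by
  have hs : 0 < conf κ r := div_pos (by norm_num) h
  have hcs := Real.sin_sq_add_cos_sq θ
  have a := hN.2 (1, 0)
  have b := hN.2 (0, 1)
  simp only [metric, sigma_cylinder, tangent, d₁_cylinder, d₂_cylinder] at a b
  simp [cylinder] at a b
  rw [b] at a
  have hx : N 1 * Real.cos θ - N 0 * Real.sin θ = 0 := by
    have : conf κ r ^ 2 * r * (N 1 * Real.cos θ - N 0 * Real.sin θ) = 0 := by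
      linear_combination a
    exact (mul_eq_zero.1 this).resolve_left (by positivity)
  refine ⟨hx, ?_⟩
  linear_combination b + conf κ r * τ * r * hx

theorem unitNormal_plane {κ τ r : ℝ} (h : 0 < 4 + κ * r ^ 2) {θ c : ℝ} {M : E3}
    (hM : IsUnitNormal κ τ (plane c) (r * Real.cos θ) (r * Real.sin θ) M) :
    ∃ β, M = ![-(β * Real.sin θ), β * Real.cos θ, M 2] := by
  have hs : 0 < conf κ r := div_pos (by norm_num) h
  have hcyl : plane c (r * Real.cos θ) (r * Real.sin θ) = cylinder r θ c := rfl
  have a := hM.2 (1, 0)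
  have b := hM.2 (0, 1)
  rw [tangent_plane, hcyl] at a b
  simp only [metric, sigma_cylinder] at a b
  simp [cylinder] at a b
  set s := conf κ r
  set w := s * τ * (r * Real.sin θ * M 0 - r * Real.cos θ * M 1) + M 2
  -- Here w = ω(M); the two orthogonality equations are solved for the horizontal coordinates of M.
  refine ⟨w * τ * r / s, ?_⟩
  ext i
  fin_cases i
  · simp
    field_simp
    have : s * (s * M 0 + w * τ * r * Real.sin θ) = 0 := by linear_combination a
    linear_combination (mul_eq_zero.1 this).resolve_left hs.ne'
  · simp
    field_simp
    have : s * (s * M 1 - w * τ * r * Real.cos θ) = 0 := by linear_combination b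
    linear_combination (mul_eq_zero.1 this).resolve_left hs.ne'
  · simp

/-- The unit normals of the cylinder and of the planes `z = c` are orthogonal. -/
theorem metric_unitNormals {κ τ r : ℝ} (hr : 0 < r) (h : 0 < 4 + κ * r ^ 2) {θ c : ℝ} {N M : E3}
    (hN : IsUnitNormal κ τ (cylinder r) θ c N)
    (hM : IsUnitNormal κ τ (plane c) (r * Real.cos θ) (r * Real.sin θ) M) :
    metric κ τ (cylinder r θ c) N M = 0 := by
  obtain ⟨hx, h2⟩ := unitNormal_cylinder hr h hN
  obtain ⟨β, hβ⟩ := unitNormal_plane h hM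
  rw [hβ]
  simp only [metric, sigma_cylinder]
  simp [cylinder]
  rw [h2]
  have e : r * Real.sin θ * N 0 - r * Real.cos θ * N 1 = 0 := by linear_combination -r * hx
  rw [e]
  linear_combination conf κ r ^ 2 * β * hx

/-- The conormal is radial. Its product with the tangent of the circle is the angular coordinate
times σ²r(1 + τ²r²), and this factor is positive. The curvature in question is thus that of a radial
line. -/
theorem secondFF_plane_conormal {κ τ r : ℝ} (hr : 0 < r) (h : 0 < 4 + κ * r ^ 2) {θ c : ℝ}
    {M : E3} (hM : IsUnitNormal κ τ (plane c) (r * Real.cos θ) (r * Real.sin θ) M) {η : ℝ × ℝ}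
    (hη : IsUnitConormal κ τ (plane c) (r * Real.cos θ) (r * Real.sin θ)
      (d₁ (cylinder r) θ c) η) :
    secondFF κ τ (plane c) (r * Real.cos θ) (r * Real.sin θ) (-M) η η = 0 := by
  have hs : 0 < conf κ r := div_pos (by norm_num) h
  have hcs := Real.sin_sq_add_cos_sq θ
  obtain ⟨β, hβ⟩ := unitNormal_plane h hM
  have a := hη.2
  have hcyl : plane c (r * Real.cos θ) (r * Real.sin θ) = cylinder r θ c := rfl
  rw [tangent_plane, hcyl, d₁_cylinder] at a
  simp only [metric, sigma_cylinder] at a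
  simp [cylinder] at a
  have hx : η.2 * Real.cos θ - η.1 * Real.sin θ = 0 := by
    have : conf κ r ^ 2 * r * (1 + τ ^ 2 * r ^ 2) * (η.2 * Real.cos θ - η.1 * Real.sin θ) = 0 := by
      linear_combination a -
        conf κ r ^ 2 * τ ^ 2 * r ^ 3 * (η.2 * Real.cos θ - η.1 * Real.sin θ) * hcs
    exact (mul_eq_zero.1 this).resolve_left (by positivity)
  have hη' : (![η.1, η.2, 0] : E3) = ![(η.1 * Real.cos θ + η.2 * Real.sin θ) * Real.cos θ,
      (η.1 * Real.cos θ + η.2 * Real.sin θ) * Real.sin θ, 0] := by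
    ext i
    fin_cases i
    · simp
      linear_combination -η.1 * hcs - Real.sin θ * hx
    · simp
      linear_combination -η.2 * hcs + Real.cos θ * hx
    · simp
  have hM' : -M = ![-(-β * Real.sin θ), -β * Real.cos θ, -M 2] := by
    rw [hβ]
    ext i
    fin_cases i <;> simp
  rw [secondFF_plane, hη', hM']
  exact christoffel_radial h τ θ c _ _ _

/-- Orthogonality gives cos γ = 0, so the curvature of the cylinder never has to be computed. -/
theorem robinCoeff_eq_zero {κ τ r : ℝ} (hr : 0 < r) (h : 0 < 4 + κ * r ^ 2) {θ c : ℝ}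
    {N M : E3} (hN : IsUnitNormal κ τ (cylinder r) θ c N)
    (hM : IsUnitNormal κ τ (plane c) (r * Real.cos θ) (r * Real.sin θ) M) (ξ : ℝ × ℝ) {η : ℝ × ℝ}
    (hη : IsUnitConormal κ τ (plane c) (r * Real.cos θ) (r * Real.sin θ)
      (d₁ (cylinder r) θ c) η) :
    robinCoeff κ τ (cylinder r) θ c N ξ (plane c) (r * Real.cos θ) (r * Real.sin θ) M η = 0 := by
  simp [robinCoeff, metric_unitNormals hr h hN hM, secondFF_plane_conormal hr h hM hη]

/-! ### Differentiation of double integrals with respect to a parameter -/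

section

open MeasureTheory Set

/-- As a single integral over a compact rectangle, the double integral admits a constant as
dominating function. -/
theorem iterated_eq_setIntegral {a b : ℝ} (ha : 0 ≤ a) (hb : 0 ≤ b) (f : ℝ → ℝ → ℝ)
    (hf : ContinuousOn (fun q : ℝ × ℝ => f q.1 q.2) (Icc 0 a ×ˢ Icc 0 b)) :
    ∫ x in (0 : ℝ)..a, ∫ y in (0 : ℝ)..b, f x y = ∫ q in Icc 0 a ×ˢ Icc 0 b, f q.1 q.2 := by
  have hi : IntegrableOn (fun q : ℝ × ℝ => f q.1 q.2) (Icc 0 a ×ˢ Icc 0 b)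
      ((volume : Measure ℝ).prod (volume : Measure ℝ)) :=
    hf.integrableOn_compact (isCompact_Icc.prod isCompact_Icc)
  rw [Measure.volume_eq_prod, setIntegral_prod _ hi]
  simp only [intervalIntegral.integral_of_le ha, intervalIntegral.integral_of_le hb,
    integral_Icc_eq_integral_Ioc]

/-- A function that is continuous on a neighbourhood `{|e| < δ}` of the compact rectangle
`Icc 0 a ×ˢ Icc 0 b` is bounded there, locally in `e`. -/
theorem exists_bound_near {a b δ : ℝ} (h : ℝ → ℝ → ℝ → ℝ)
    (hc : ContinuousOn (fun q : ℝ × ℝ × ℝ => h q.1 q.2.1 q.2.2)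
      (Ioo (-δ) δ ×ˢ Icc 0 a ×ˢ Icc 0 b)) {e : ℝ} (he : e ∈ Ioo (-δ) δ) :
    ∃ s ∈ nhds e, s ⊆ Ioo (-δ) δ ∧ ∃ C : ℝ, ∀ x ∈ s, ∀ q ∈ Icc 0 a ×ˢ Icc 0 b,
      ‖h x q.1 q.2‖ ≤ C := by
  obtain ⟨u, v, hev, hmem, hsub⟩ := exists_Icc_mem_subset_of_mem_nhds (isOpen_Ioo.mem_nhds he)
  obtain ⟨C, hC⟩ := (isCompact_Icc.prod (isCompact_Icc.prod isCompact_Icc)).exists_bound_of_continuousOn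
    (hc.mono (prod_mono hsub (subset_refl (Icc 0 a ×ˢ Icc 0 b))))
  exact ⟨Icc u v, hmem, hsub, C, fun x hx q hq => hC (x, q) ⟨hx, hq⟩⟩

theorem continuousOn_section {a b : ℝ} {s : Set ℝ} {h : ℝ → ℝ → ℝ → ℝ}
    (hc : ContinuousOn (fun q : ℝ × ℝ × ℝ => h q.1 q.2.1 q.2.2) (s ×ˢ Icc 0 a ×ˢ Icc 0 b))
    {e : ℝ} (he : e ∈ s) :
    ContinuousOn (fun q : ℝ × ℝ => h e q.1 q.2) (Icc 0 a ×ˢ Icc 0 b) :=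
  hc.comp (f := fun q : ℝ × ℝ => (e, q)) (by fun_prop) fun _ hq => ⟨he, hq⟩

theorem continuousAt_iterated_integral {a b δ : ℝ} (ha : 0 ≤ a) (hb : 0 ≤ b)
    (h : ℝ → ℝ → ℝ → ℝ)
    (hc : ContinuousOn (fun q : ℝ × ℝ × ℝ => h q.1 q.2.1 q.2.2)
      (Ioo (-δ) δ ×ˢ Icc 0 a ×ˢ Icc 0 b)) {e : ℝ} (he : e ∈ Ioo (-δ) δ) :
    ContinuousAt (fun e => ∫ x in (0 : ℝ)..a, ∫ y in (0 : ℝ)..b, h e x y) e := by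
  have hev : (fun e => ∫ x in (0 : ℝ)..a, ∫ y in (0 : ℝ)..b, h e x y) =ᶠ[nhds e]
      fun e => ∫ q in Icc 0 a ×ˢ Icc 0 b, h e q.1 q.2 := by
    filter_upwards [isOpen_Ioo.mem_nhds he] with x hx
    exact iterated_eq_setIntegral ha hb (h x) (continuousOn_section hc hx)
  have hK : IsCompact (Icc 0 a ×ˢ Icc 0 b) := isCompact_Icc.prod isCompact_Icc
  have hKm : MeasurableSet (Icc 0 a ×ˢ Icc 0 b) := measurableSet_Icc.prod measurableSet_Icc
  obtain ⟨s, hs, hsub, C, hC⟩ := exists_bound_near h hc he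
  refine (continuousAt_congr hev).2 ?_
  refine continuousAt_of_dominated (bound := fun _ => C) ?_ ?_ ?_ ?_
  · filter_upwards [hs] with x hx
    exact (continuousOn_section hc (hsub hx)).aestronglyMeasurable hKm
  · filter_upwards [hs] with x hx
    filter_upwards [ae_restrict_mem hKm] with q hq
    exact hC x hx q hq
  · exact integrableOn_const hK.measure_lt_top.ne
  · filter_upwards [ae_restrict_mem hKm] with q hq
    have : ContinuousOn (fun x => h x q.1 q.2) (Ioo (-δ) δ) :=
      hc.comp (f := fun x : ℝ => (x, q)) (by fun_prop) fun _ hx => ⟨hx, hq⟩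
    exact this.continuousAt (isOpen_Ioo.mem_nhds he)

theorem hasDerivAt_iterated_integral {a b δ : ℝ} (ha : 0 ≤ a) (hb : 0 ≤ b)
    (h h' : ℝ → ℝ → ℝ → ℝ)
    (hc : ContinuousOn (fun q : ℝ × ℝ × ℝ => h q.1 q.2.1 q.2.2)
      (Ioo (-δ) δ ×ˢ Icc 0 a ×ˢ Icc 0 b))
    (hc' : ContinuousOn (fun q : ℝ × ℝ × ℝ => h' q.1 q.2.1 q.2.2)
      (Ioo (-δ) δ ×ˢ Icc 0 a ×ˢ Icc 0 b))
    (hd : ∀ e ∈ Ioo (-δ) δ, ∀ x ∈ Icc 0 a, ∀ y ∈ Icc 0 b,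
      HasDerivAt (fun e => h e x y) (h' e x y) e) {e : ℝ} (he : e ∈ Ioo (-δ) δ) :
    HasDerivAt (fun e => ∫ x in (0 : ℝ)..a, ∫ y in (0 : ℝ)..b, h e x y)
      (∫ x in (0 : ℝ)..a, ∫ y in (0 : ℝ)..b, h' e x y) e := by
  have hev : (fun e => ∫ x in (0 : ℝ)..a, ∫ y in (0 : ℝ)..b, h e x y) =ᶠ[nhds e]
      fun e => ∫ q in Icc 0 a ×ˢ Icc 0 b, h e q.1 q.2 := by
    filter_upwards [isOpen_Ioo.mem_nhds he] with x hx
    exact iterated_eq_setIntegral ha hb (h x) (continuousOn_section hc hx)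
  have hK : IsCompact (Icc 0 a ×ˢ Icc 0 b) := isCompact_Icc.prod isCompact_Icc
  have hKm : MeasurableSet (Icc 0 a ×ˢ Icc 0 b) := measurableSet_Icc.prod measurableSet_Icc
  obtain ⟨s, hs, hsub, C, hC⟩ := exists_bound_near h' hc' he
  rw [iterated_eq_setIntegral ha hb (h' e) (continuousOn_section hc' he)]
  refine HasDerivAt.congr_of_eventuallyEq ?_ hev
  refine (hasDerivAt_integral_of_dominated_loc_of_deriv_le (s := s) (bound := fun _ => C)
    (F := fun e (q : ℝ × ℝ) => h e q.1 q.2) (F' := fun e (q : ℝ × ℝ) => h' e q.1 q.2)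
    hs ?_ ?_ ?_ ?_ ?_ ?_).2
  · filter_upwards [hs] with x hx
    exact (continuousOn_section hc (hsub hx)).aestronglyMeasurable hKm
  · exact (continuousOn_section hc he).integrableOn_compact hK
  · exact (continuousOn_section hc' he).aestronglyMeasurable hKm
  · filter_upwards [ae_restrict_mem hKm] with q hq
    exact fun x hx => hC x hx q hq
  · exact integrableOn_const hK.measure_lt_top.ne
  · filter_upwards [ae_restrict_mem hKm] with q hq
    exact fun x hx => hd x (hsub hx) q.1 hq.1 q.2 hq.2

end

section

open Set

/-! ### Slices and mixed partial derivatives -/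

section Slices

variable {G : Type*} [NormedAddCommGroup G] [NormedSpace ℝ G]

theorem hasDerivAt_slice₀ {f : ℝ × ℝ × ℝ → G} {e θ t : ℝ} (hf : DifferentiableAt ℝ f (e, θ, t)) :
    HasDerivAt (fun e => f (e, θ, t)) (fderiv ℝ f (e, θ, t) (1, 0, 0)) e :=
  hf.hasFDerivAt.comp_hasDerivAt (f := fun e : ℝ => ((e, θ, t) : ℝ × ℝ × ℝ)) e
    ((hasDerivAt_id' e).prodMk ((hasDerivAt_const e θ).prodMk (hasDerivAt_const e t)))

theorem hasDerivAt_slice₁ {f : ℝ × ℝ × ℝ → G} {e θ t : ℝ} (hf : DifferentiableAt ℝ f (e, θ, t)) :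
    HasDerivAt (fun θ => f (e, θ, t)) (fderiv ℝ f (e, θ, t) (0, 1, 0)) θ :=
  hf.hasFDerivAt.comp_hasDerivAt (f := fun θ : ℝ => ((e, θ, t) : ℝ × ℝ × ℝ)) θ
    ((hasDerivAt_const θ e).prodMk ((hasDerivAt_id' θ).prodMk (hasDerivAt_const θ t)))

theorem hasDerivAt_slice₂ {f : ℝ × ℝ × ℝ → G} {e θ t : ℝ} (hf : DifferentiableAt ℝ f (e, θ, t)) :
    HasDerivAt (fun t => f (e, θ, t)) (fderiv ℝ f (e, θ, t) (0, 0, 1)) t :=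
  hf.hasFDerivAt.comp_hasDerivAt (f := fun t : ℝ => ((e, θ, t) : ℝ × ℝ × ℝ)) t
    ((hasDerivAt_const t e).prodMk ((hasDerivAt_const t θ).prodMk (hasDerivAt_id' t)))

theorem contDiff_fderiv_apply {E : Type*} [NormedAddCommGroup E] [NormedSpace ℝ E] {f : E → G}
    (hf : ContDiff ℝ ∞ f) (v : E) : ContDiff ℝ ∞ fun q => fderiv ℝ f q v :=
  (hf.fderiv_right (m := ∞) (by simp)).clm_apply contDiff_const

theorem fderiv_fderiv_comm {E : Type*} [NormedAddCommGroup E] [NormedSpace ℝ E] {f : E → G}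
    (hf : ContDiff ℝ ∞ f) (q v w : E) :
    fderiv ℝ (fun q => fderiv ℝ f q v) q w = fderiv ℝ (fun q => fderiv ℝ f q w) q v := by
  have hd : DifferentiableAt ℝ (fderiv ℝ f) q :=
    ((hf.fderiv_right (m := ∞) (by simp)).differentiable (by simp)).differentiableAt
  have h (v w : E) : fderiv ℝ (fun q => fderiv ℝ f q v) q w = fderiv ℝ (fderiv ℝ f) q w v := by
    rw [fderiv_clm_apply hd (differentiableAt_const v)]
    simp
  rw [h, h]
  exact (hf.contDiffAt.isSymmSndFDerivAt (by
    rw [minSmoothness_of_isRCLikeNormedField]; exact WithTop.coe_le_coe.2 (le_top : (2 : ℕ∞) ≤ ⊤))).eq w v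

end Slices

/-! ### Variation of the area element -/

/-- The squared area of the parallelogram spanned by `u` and `v`. -/
def gram (κ τ : ℝ) (p u v : E3) : ℝ :=
  metric κ τ p u u * metric κ τ p v v - metric κ τ p u v ^ 2

theorem contDiffAt_metric {E : Type*} [NormedAddCommGroup E] [NormedSpace ℝ E] {κ : ℝ} (τ : ℝ)
    {p u v : E → E3} {q : E} (hp : ContDiffAt ℝ ∞ p q) (hu : ContDiffAt ℝ ∞ u q)
    (hv : ContDiffAt ℝ ∞ v q) (h : 4 + κ * (p q 0 ^ 2 + p q 1 ^ 2) ≠ 0) :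
    ContDiffAt ℝ ∞ (fun q => metric κ τ (p q) (u q) (v q)) q := by
  have hp' := contDiffAt_pi.1 hp
  have hu' := contDiffAt_pi.1 hu
  have hv' := contDiffAt_pi.1 hv
  have hp0 := hp' 0
  have hp1 := hp' 1
  have hu0 := hu' 0
  have hu1 := hu' 1
  have hu2 := hu' 2
  have hv0 := hv' 0
  have hv1 := hv' 1
  have hv2 := hv' 2
  have hD : ContDiffAt ℝ ∞ (fun q => 4 + κ * (p q 0 ^ 2 + p q 1 ^ 2)) q := by fun_prop
  have hσ : ContDiffAt ℝ ∞ (fun q => sigma κ (p q)) q := contDiffAt_const.div hD h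
  unfold metric
  fun_prop

theorem contDiffAt_gram {E : Type*} [NormedAddCommGroup E] [NormedSpace ℝ E] {κ : ℝ} (τ : ℝ)
    {p u v : E → E3} {q : E} (hp : ContDiffAt ℝ ∞ p q) (hu : ContDiffAt ℝ ∞ u q)
    (hv : ContDiffAt ℝ ∞ v q) (h : 4 + κ * (p q 0 ^ 2 + p q 1 ^ 2) ≠ 0) :
    ContDiffAt ℝ ∞ (fun q => gram κ τ (p q) (u q) (v q)) q :=
  ((contDiffAt_metric τ hp hu hu h).mul (contDiffAt_metric τ hp hv hv h)).sub
    ((contDiffAt_metric τ hp hu hv h).pow 2)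

theorem hasDerivAt_sigma {κ e : ℝ} {p : ℝ → E3} {p' : E3} (hp : HasDerivAt p p' e)
    (h : 4 + κ * (p e 0 ^ 2 + p e 1 ^ 2) ≠ 0) :
    HasDerivAt (fun e => sigma κ (p e))
      (-(κ / 2) * sigma κ (p e) ^ 2 * (p e 0 * p' 0 + p e 1 * p' 1)) e := by
  have h0 := hasDerivAt_pi.1 hp 0
  have h1 := hasDerivAt_pi.1 hp 1
  have hD := (((h0.fun_pow 2).fun_add (h1.fun_pow 2)).const_mul κ).const_add 4
  refine ((hasDerivAt_const e (4 : ℝ)).fun_div hD h).congr_deriv ?_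
  unfold sigma
  field_simp
  ring

theorem hasDerivAt_connectionForm {κ τ e : ℝ} {p u : ℝ → E3} {p' u' : E3}
    (hp : HasDerivAt p p' e) (hu : HasDerivAt u u' e)
    (h : 4 + κ * (p e 0 ^ 2 + p e 1 ^ 2) ≠ 0) :
    HasDerivAt (fun e => sigma κ (p e) * τ * (p e 1 * u e 0 - p e 0 * u e 1) + u e 2)
      (-(κ / 2) * sigma κ (p e) ^ 2 * (p e 0 * p' 0 + p e 1 * p' 1) * τ *
          (p e 1 * u e 0 - p e 0 * u e 1)
        + sigma κ (p e) * τ * (p' 1 * u e 0 + p e 1 * u' 0 - (p' 0 * u e 1 + p e 0 * u' 1))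
        + u' 2) e := by
  have p0 := hasDerivAt_pi.1 hp 0
  have p1 := hasDerivAt_pi.1 hp 1
  have u0 := hasDerivAt_pi.1 hu 0
  have u1 := hasDerivAt_pi.1 hu 1
  have u2 := hasDerivAt_pi.1 hu 2
  exact ((((hasDerivAt_sigma hp h).mul_const τ).fun_mul
    ((p1.fun_mul u0).fun_sub (p0.fun_mul u1))).fun_add u2)

/-- The values of σ and of the connection form, with their derivatives, enter as free variables, so
that a caller can supply them already simplified. -/
theorem hasDerivAt_metric {κ τ e : ℝ} {p u v : ℝ → E3} {p' u' v' : E3}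
    (hp : HasDerivAt p p' e) (hu : HasDerivAt u u' e) (hv : HasDerivAt v v' e)
    (h : 4 + κ * (p e 0 ^ 2 + p e 1 ^ 2) ≠ 0) {σ σ' a a' b b' : ℝ}
    (hσ : sigma κ (p e) = σ)
    (hσ' : -(κ / 2) * σ ^ 2 * (p e 0 * p' 0 + p e 1 * p' 1) = σ')
    (ha : σ * τ * (p e 1 * u e 0 - p e 0 * u e 1) + u e 2 = a)
    (ha' : σ' * τ * (p e 1 * u e 0 - p e 0 * u e 1)
      + σ * τ * (p' 1 * u e 0 + p e 1 * u' 0 - (p' 0 * u e 1 + p e 0 * u' 1)) + u' 2 = a')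
    (hb : σ * τ * (p e 1 * v e 0 - p e 0 * v e 1) + v e 2 = b)
    (hb' : σ' * τ * (p e 1 * v e 0 - p e 0 * v e 1)
      + σ * τ * (p' 1 * v e 0 + p e 1 * v' 0 - (p' 0 * v e 1 + p e 0 * v' 1)) + v' 2 = b') :
    HasDerivAt (fun e => metric κ τ (p e) (u e) (v e))
      (2 * σ * σ' * (u e 0 * v e 0 + u e 1 * v e 1)
        + σ ^ 2 * (u' 0 * v e 0 + u e 0 * v' 0 + (u' 1 * v e 1 + u e 1 * v' 1))
        + (a' * b + a * b')) e := by
  subst hσ hσ' ha ha' hb hb'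
  have u0 := hasDerivAt_pi.1 hu 0
  have u1 := hasDerivAt_pi.1 hu 1
  have v0 := hasDerivAt_pi.1 hv 0
  have v1 := hasDerivAt_pi.1 hv 1
  have hs := hasDerivAt_sigma hp h
  refine (((hs.fun_pow 2).fun_mul ((u0.fun_mul v0).fun_add (u1.fun_mul v1))).fun_add
    ((hasDerivAt_connectionForm (τ := τ) hp hu h).fun_mul
      (hasDerivAt_connectionForm (τ := τ) hp hv h))).congr_deriv ?_
  simp only [Nat.cast_ofNat, Nat.add_one_sub_one, pow_one]

theorem gram_cylinder (κ τ r θ t : ℝ) :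
    gram κ τ (cylinder r θ t) ![-(r * Real.sin θ), r * Real.cos θ, 0] ![0, 0, 1] =
      (conf κ r * r) ^ 2 := by
  have hcs := Real.sin_sq_add_cos_sq θ
  simp only [gram, metric, sigma_cylinder]
  simp [cylinder]
  linear_combination (conf κ r * r) ^ 2 * hcs

/-- First variation of the squared area element of the cylinder. -/
theorem hasDerivAt_gram_cylinder {κ τ r θ t e : ℝ} (h : 0 < 4 + κ * r ^ 2)
    {p u v : ℝ → E3} {p' u' v' : E3}
    (hp : HasDerivAt p p' e) (hu : HasDerivAt u u' e) (hv : HasDerivAt v v' e)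
    (hpe : p e = cylinder r θ t) (hue : u e = ![-(r * Real.sin θ), r * Real.cos θ, 0])
    (hve : v e = ![0, 0, 1]) :
    HasDerivAt (fun e => gram κ τ (p e) (u e) (v e))
      (2 * conf κ r * r * (-(κ / 2) * conf κ r ^ 2 * r ^ 2 * (p' 0 * Real.cos θ + p' 1 * Real.sin θ)
        + conf κ r * (u' 1 * Real.cos θ - u' 0 * Real.sin θ) + conf κ r * r * v' 2)) e := by
  have hcs := Real.sin_sq_add_cos_sq θ
  set c := Real.cos θ
  set s := Real.sin θ
  set σ := conf κ r
  have p0 : p e 0 = r * c := by rw [hpe]; rfl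
  have p1 : p e 1 = r * s := by rw [hpe]; rfl
  have u0 : u e 0 = -(r * s) := by rw [hue]; rfl
  have u1 : u e 1 = r * c := by rw [hue]; rfl
  have u2 : u e 2 = 0 := by rw [hue]; rfl
  have v0 : v e 0 = 0 := by rw [hve]; rfl
  have v1 : v e 1 = 0 := by rw [hve]; rfl
  have v2 : v e 2 = 1 := by rw [hve]; rfl
  have hD : 4 + κ * (p e 0 ^ 2 + p e 1 ^ 2) ≠ 0 := by
    have : 4 + κ * (p e 0 ^ 2 + p e 1 ^ 2) = 4 + κ * r ^ 2 := by
      rw [p0, p1]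
      linear_combination (κ * r ^ 2) * hcs
    rw [this]; exact h.ne'
  have hσ : sigma κ (p e) = σ := by rw [hpe]; exact sigma_cylinder κ r θ t
  have hσ' : -(κ / 2) * σ ^ 2 * (p e 0 * p' 0 + p e 1 * p' 1) =
      -(κ / 2) * σ ^ 2 * r * (p' 0 * c + p' 1 * s) := by
    rw [p0, p1]; ring
  generalize hdσ : -(κ / 2) * σ ^ 2 * r * (p' 0 * c + p' 1 * s) = dσ at hσ'
  have ha : σ * τ * (p e 1 * u e 0 - p e 0 * u e 1) + u e 2 = -(σ * τ * r ^ 2) := by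
    rw [p0, p1, u0, u1, u2]
    linear_combination -(σ * τ * r ^ 2) * hcs
  have ha' : dσ * τ * (p e 1 * u e 0 - p e 0 * u e 1)
      + σ * τ * (p' 1 * u e 0 + p e 1 * u' 0 - (p' 0 * u e 1 + p e 0 * u' 1)) + u' 2 =
      -(dσ * τ * r ^ 2) - σ * τ * r * ((p' 0 * c + p' 1 * s) + (u' 1 * c - u' 0 * s)) + u' 2 := by
    rw [p0, p1, u0, u1]
    linear_combination -(dσ * τ * r ^ 2) * hcs
  have hb : σ * τ * (p e 1 * v e 0 - p e 0 * v e 1) + v e 2 = 1 := by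
    rw [v0, v1, v2]; ring
  have hb' : dσ * τ * (p e 1 * v e 0 - p e 0 * v e 1)
      + σ * τ * (p' 1 * v e 0 + p e 1 * v' 0 - (p' 0 * v e 1 + p e 0 * v' 1)) + v' 2 =
      -(σ * τ * r * (v' 1 * c - v' 0 * s)) + v' 2 := by
    rw [p0, p1, v0, v1]; ring
  have hE := hasDerivAt_metric hp hu hu hD hσ hσ' ha ha' ha ha'
  have hG := hasDerivAt_metric hp hv hv hD hσ hσ' hb hb' hb hb'
  have hF := hasDerivAt_metric hp hu hv hD hσ hσ' ha ha' hb hb'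
  refine ((hE.fun_mul hG).fun_sub (hF.fun_pow 2)).congr_deriv ?_
  have eE : metric κ τ (p e) (u e) (u e) = σ ^ 2 * r ^ 2 + (σ * τ * r ^ 2) ^ 2 := by
    unfold metric
    rw [hσ, ha, u0, u1]
    linear_combination σ ^ 2 * r ^ 2 * hcs
  have eG : metric κ τ (p e) (v e) (v e) = 1 := by
    unfold metric
    rw [hσ, hb, v0, v1]
    ring
  have eF : metric κ τ (p e) (u e) (v e) = -(σ * τ * r ^ 2) := by
    unfold metric
    rw [hσ, ha, hb, v0, v1]
    ring
  rw [eE, eG, eF, u0, u1, v0, v1]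
  have hσr : -(κ / 2) * σ ^ 2 * r ^ 2 * (p' 0 * c + p' 1 * s) = dσ * r := by rw [← hdσ]; ring
  rw [hσr]
  simp only [Nat.cast_ofNat, Nat.add_one_sub_one, pow_one]
  -- All terms with τ cancel: with E, F, G the metric coefficients and a = −στr², one has E = σ²r² +
  -- a², F = a and G = 1.
  linear_combination 2 * σ * dσ * r ^ 2 * hcs

end

/-! ### Volume and area along an admissible variation -/

section

open Set

/-- The forms σ dx, σ dy, ω are an orthonormal coframe, triangular in dx, dy, dz; hence τ drops out.
-/
theorem det_metric (κ τ : ℝ) (p : E3) :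
    Matrix.det (Matrix.of fun i j : Fin 3 =>
      metric κ τ p (Pi.single i 1) (Pi.single j 1)) = (sigma κ p ^ 2) ^ 2 := by
  rw [Matrix.det_fin_three]
  simp [metric]
  ring

theorem volDensity_eq (κ τ : ℝ) (p : E3) : volDensity κ τ p = sigma κ p ^ 2 := by
  rw [volDensity, det_metric, Real.sqrt_sq (sq_nonneg _)]

theorem det_rows (u v w : E3) : Matrix.det (Matrix.of ![u, v, w]) =
    u 0 * (v 1 * w 2 - v 2 * w 1) - u 1 * (v 0 * w 2 - v 2 * w 0)
      + u 2 * (v 0 * w 1 - v 1 * w 0) := by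
  rw [Matrix.det_fin_three]
  simp
  ring

theorem denom_pos_of_mem_model {κ : ℝ} {p : E3} (h : p ∈ model κ) :
    0 < 4 + κ * (p 0 ^ 2 + p 1 ^ 2) :=
  denom_pos_of_lt h (by positivity)

theorem contDiffAt_sigma {E : Type*} [NormedAddCommGroup E] [NormedSpace ℝ E] {κ : ℝ}
    {p : E → E3} {q : E} (hp : ContDiffAt ℝ ∞ p q) (h : 4 + κ * (p q 0 ^ 2 + p q 1 ^ 2) ≠ 0) :
    ContDiffAt ℝ ∞ (fun q => sigma κ (p q)) q := by
  have hp' := contDiffAt_pi.1 hp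
  have hp0 := hp' 0
  have hp1 := hp' 1
  have hD : ContDiffAt ℝ ∞ (fun q => 4 + κ * (p q 0 ^ 2 + p q 1 ^ 2)) q := by fun_prop
  exact contDiffAt_const.div hD h

namespace AdmissibleVariation

variable {κ L : ℝ} {X : ℝ → ℝ → E3} (V : AdmissibleVariation κ L X)

/-- The variation as a function of the triple `(ε, θ, t)`. -/
def total (q : ℝ × ℝ × ℝ) : E3 := V.map q.1 q.2.1 q.2.2

/-- The partial derivative of the variation in the direction `v`. -/
def partial_ (v q : ℝ × ℝ × ℝ) : E3 := fderiv ℝ V.total q v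

theorem contDiff_total : ContDiff ℝ ∞ V.total := V.smooth

theorem contDiff_partial (v : ℝ × ℝ × ℝ) : ContDiff ℝ ∞ (V.partial_ v) :=
  contDiff_fderiv_apply V.contDiff_total v

theorem differentiable_total : Differentiable ℝ V.total :=
  V.contDiff_total.differentiable (by simp)

theorem differentiable_partial (v : ℝ × ℝ × ℝ) : Differentiable ℝ (V.partial_ v) :=
  (V.contDiff_partial v).differentiable (by simp)

theorem velocity_eq (e θ t : ℝ) : velocity V.map e θ t = V.partial_ (1, 0, 0) (e, θ, t) :=
  (hasDerivAt_slice₀ (V.differentiable_total (e, θ, t))).deriv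

theorem d₁_eq (e θ t : ℝ) : d₁ (V.map e) θ t = V.partial_ (0, 1, 0) (e, θ, t) :=
  (hasDerivAt_slice₁ (V.differentiable_total (e, θ, t))).deriv

theorem d₂_eq (e θ t : ℝ) : d₂ (V.map e) θ t = V.partial_ (0, 0, 1) (e, θ, t) :=
  (hasDerivAt_slice₂ (V.differentiable_total (e, θ, t))).deriv

theorem area_eq (τ e : ℝ) : area κ τ L (V.map e) =
    ∫ θ in (0 : ℝ)..(2 * Real.pi), ∫ t in (0 : ℝ)..L,
      Real.sqrt (gram κ τ (V.total (e, θ, t)) (V.partial_ (0, 1, 0) (e, θ, t))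
        (V.partial_ (0, 0, 1) (e, θ, t))) := by
  simp only [area, d₁_eq, d₂_eq]
  rfl

theorem energy_pi_div_two (τ : ℝ) (Φ : ℝ → ℝ → ℝ → E3) :
    energy κ τ L (Real.pi / 2) Φ = fun e => area κ τ L (Φ e) := by
  funext e
  simp [energy]

theorem denom_pos {e : ℝ} (he : e ∈ Ioo (-V.δ) V.δ) (θ : ℝ) {t : ℝ} (ht : t ∈ Icc 0 L) :
    0 < 4 + κ * (V.total (e, θ, t) 0 ^ 2 + V.total (e, θ, t) 1 ^ 2) :=
  denom_pos_of_mem_model (V.mem_model e (abs_lt.2 he) θ t ht)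

/-- The density of the volume swept out by the variation. -/
def volumeDensity (e θ t : ℝ) : ℝ :=
  sigma κ (V.total (e, θ, t)) ^ 2 * Matrix.det (Matrix.of
    ![V.partial_ (1, 0, 0) (e, θ, t), V.partial_ (0, 1, 0) (e, θ, t),
      V.partial_ (0, 0, 1) (e, θ, t)])

theorem volumeChange_eq (τ ε : ℝ) : volumeChange κ τ L V.map ε =
    ∫ e in (0 : ℝ)..ε, ∫ θ in (0 : ℝ)..(2 * Real.pi), ∫ t in (0 : ℝ)..L,
      V.volumeDensity e θ t := by
  simp only [volumeChange, velocity_eq, d₁_eq, d₂_eq, volDensity_eq]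
  rfl

theorem continuousOn_volumeDensity (a : ℝ) :
    ContinuousOn (fun q : ℝ × ℝ × ℝ => V.volumeDensity q.1 q.2.1 q.2.2)
      (Ioo (-V.δ) V.δ ×ˢ Icc 0 a ×ˢ Icc 0 L) := by
  rintro ⟨e, θ, t⟩ ⟨he, -, ht⟩
  refine ContinuousAt.continuousWithinAt ?_
  have h1 : ContinuousAt (fun q => sigma κ (V.total q)) (e, θ, t) :=
    (contDiffAt_sigma V.contDiff_total.contDiffAt (V.denom_pos he θ ht).ne').continuousAt
  have h2 (v : ℝ × ℝ × ℝ) (i : Fin 3) : ContinuousAt (fun q => V.partial_ v q i) (e, θ, t) :=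
    ((continuous_apply i).comp (V.contDiff_partial v).continuous).continuousAt
  have k (i : Fin 3) := h2 (1, 0, 0) i
  have l (i : Fin 3) := h2 (0, 1, 0) i
  have m (i : Fin 3) := h2 (0, 0, 1) i
  simp only [volumeDensity, det_rows]
  change ContinuousAt (fun q => sigma κ (V.total q) ^ 2 * _) _
  exact (h1.pow 2).mul ((((k 0).mul (((l 1).mul (m 2)).sub ((l 2).mul (m 1)))).sub
    ((k 1).mul (((l 0).mul (m 2)).sub ((l 2).mul (m 0))))).add
    ((k 2).mul (((l 0).mul (m 1)).sub ((l 1).mul (m 0)))))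

/-- The swept volume vanishes identically near ε = 0, and its derivative at 0 is this integral by
the fundamental theorem of calculus. -/
theorem integral_volumeDensity_eq_zero (hL : 0 < L) {τ : ℝ} (hV : V.IsVolumePreserving τ) :
    ∫ θ in (0 : ℝ)..(2 * Real.pi), ∫ t in (0 : ℝ)..L, V.volumeDensity 0 θ t = 0 := by
  have h0 : (0 : ℝ) ∈ Ioo (-V.δ) V.δ := ⟨by linarith [V.δ_pos], V.δ_pos⟩
  have hc : ContinuousOn (fun e => ∫ θ in (0 : ℝ)..(2 * Real.pi), ∫ t in (0 : ℝ)..L,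
      V.volumeDensity e θ t) (Ioo (-V.δ) V.δ) := fun e he =>
    (continuousAt_iterated_integral Real.two_pi_pos.le hL.le _
      (V.continuousOn_volumeDensity _) he).continuousWithinAt
  have h1 := intervalIntegral.integral_hasDerivAt_right (a := 0) (b := 0)
    (IntervalIntegrable.refl)
    (hc.stronglyMeasurableAtFilter isOpen_Ioo 0 h0) (hc.continuousAt (isOpen_Ioo.mem_nhds h0))
  refine h1.unique ((hasDerivAt_const (0 : ℝ) (0 : ℝ)).congr_of_eventuallyEq ?_)
  filter_upwards [isOpen_Ioo.mem_nhds h0] with e he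
  rw [← V.volumeChange_eq τ, hV e (abs_lt.2 he)]

/-- The squared area element of the annuli. -/
def areaSq (τ : ℝ) (q : ℝ × ℝ × ℝ) : ℝ :=
  gram κ τ (V.total q) (V.partial_ (0, 1, 0) q) (V.partial_ (0, 0, 1) q)

theorem contDiffAt_areaSq (τ : ℝ) {q : ℝ × ℝ × ℝ}
    (hq : 0 < 4 + κ * (V.total q 0 ^ 2 + V.total q 1 ^ 2)) :
    ContDiffAt ℝ ∞ (V.areaSq τ) q :=
  contDiffAt_gram τ V.contDiff_total.contDiffAt (V.contDiff_partial _).contDiffAt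
    (V.contDiff_partial _).contDiffAt hq.ne'

/-- Differentiation of the area of an immersed annulus along a variation. -/
theorem hasDerivAt_area (hL : 0 < L) (τ : ℝ)
    (hpos : ∀ θ, ∀ t ∈ Icc 0 L, 0 < V.areaSq τ (0, θ, t)) :
    HasDerivAt (fun e => area κ τ L (V.map e))
      (∫ θ in (0 : ℝ)..(2 * Real.pi), ∫ t in (0 : ℝ)..L,
        fderiv ℝ (V.areaSq τ) (0, θ, t) (1, 0, 0) / (2 * Real.sqrt (V.areaSq τ (0, θ, t)))) 0 := by
  have h0 : (0 : ℝ) ∈ Ioo (-V.δ) V.δ := ⟨by linarith [V.δ_pos], V.δ_pos⟩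
  -- By compactness the annuli remain immersed for small ε, which keeps the square root
  -- differentiable.
  have hev : ∀ᶠ e in nhds (0 : ℝ), ∀ q ∈ Icc 0 (2 * Real.pi) ×ˢ Icc 0 L,
      0 < V.areaSq τ (e, q) := by
    refine (isCompact_Icc.prod isCompact_Icc).eventually_forall_of_forall_eventually ?_
    rintro ⟨θ, t⟩ ⟨-, ht⟩
    exact (V.contDiffAt_areaSq τ (V.denom_pos h0 θ ht)).continuousAt.eventually_const_lt
      (hpos θ t ht)
  obtain ⟨η, hη, hball⟩ := Metric.eventually_nhds_iff.1 hev
  set δ := min η V.δ with hδ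
  have hδ0 : 0 < δ := lt_min hη V.δ_pos
  have hsub : ∀ e ∈ Ioo (-δ) δ, e ∈ Ioo (-V.δ) V.δ := fun e he =>
    ⟨by linarith [he.1, min_le_right η V.δ], he.2.trans_le (min_le_right _ _)⟩
  have hS : ∀ e ∈ Ioo (-δ) δ, ∀ θ ∈ Icc 0 (2 * Real.pi), ∀ t ∈ Icc 0 L,
      0 < V.areaSq τ (e, θ, t) := fun e he θ hθ t ht => by
    refine hball ?_ (θ, t) ⟨hθ, ht⟩
    rw [Real.dist_eq, sub_zero]
    exact (abs_lt.2 he).trans_le (min_le_left _ _)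
  have harea : (fun e => area κ τ L (V.map e)) = fun e =>
      ∫ θ in (0 : ℝ)..(2 * Real.pi), ∫ t in (0 : ℝ)..L, Real.sqrt (V.areaSq τ (e, θ, t)) := by
    funext e
    exact V.area_eq τ e
  rw [harea]
  refine hasDerivAt_iterated_integral (δ := δ) Real.two_pi_pos.le hL.le
    (fun e θ t => Real.sqrt (V.areaSq τ (e, θ, t)))
    (fun e θ t => fderiv ℝ (V.areaSq τ) (e, θ, t) (1, 0, 0) /
      (2 * Real.sqrt (V.areaSq τ (e, θ, t)))) ?_ ?_ ?_ ⟨by linarith, hδ0⟩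
  · rintro ⟨e, θ, t⟩ ⟨he, hθ, ht⟩
    exact (V.contDiffAt_areaSq τ
      (V.denom_pos (hsub e he) θ ht)).continuousAt.sqrt.continuousWithinAt
  · rintro ⟨e, θ, t⟩ ⟨he, hθ, ht⟩
    have hs := V.contDiffAt_areaSq τ (V.denom_pos (hsub e he) θ ht)
    have h1 : ContinuousAt (fun q => fderiv ℝ (V.areaSq τ) q (1, 0, 0)) (e, θ, t) :=
      (hs.fderiv_right (m := ∞) (by simp)).continuousAt.clm_apply continuousAt_const
    refine ContinuousAt.continuousWithinAt ?_
    refine h1.div (continuousAt_const.mul hs.continuousAt.sqrt) ?_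
    exact (mul_pos two_pos (Real.sqrt_pos.2 (hS e he θ hθ t ht))).ne'
  · intro e he θ hθ t ht
    have hs := V.contDiffAt_areaSq τ (V.denom_pos (hsub e he) θ ht)
    exact (hasDerivAt_slice₀ (hs.differentiableAt (by simp))).sqrt (hS e he θ hθ t ht).ne'

end AdmissibleVariation

end

/-! ### First variation of the cylinder -/

section

open Set

namespace AdmissibleVariation

variable {κ L r : ℝ} (V : AdmissibleVariation κ L (cylinder r))

theorem total_zero (θ : ℝ) {t : ℝ} (ht : t ∈ Icc 0 L) : V.total (0, θ, t) = cylinder r θ t :=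
  V.map_zero θ t ht

theorem partial_angle_zero (θ : ℝ) {t : ℝ} (ht : t ∈ Icc 0 L) :
    V.partial_ (0, 1, 0) (0, θ, t) = ![-(r * Real.sin θ), r * Real.cos θ, 0] := by
  refine (hasDerivAt_slice₁ (V.differentiable_total (0, θ, t))).unique ?_
  rw [funext fun θ => V.total_zero θ ht]
  exact hasDerivAt_cylinder_left r θ t

theorem partial_height_zero (hL : 0 < L) (θ : ℝ) {t : ℝ} (ht : t ∈ Icc 0 L) :
    V.partial_ (0, 0, 1) (0, θ, t) = ![0, 0, 1] := by
  -- The variation agrees with the cylinder only for 0 ≤ t ≤ L, so the derivatives are compared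
  -- within this interval; at its ends they are one-sided.
  refine (uniqueDiffOn_Icc hL t ht).eq_deriv _
    (hasDerivAt_slice₂ (V.differentiable_total (0, θ, t))).hasDerivWithinAt ?_
  exact (hasDerivAt_cylinder_right r θ t).hasDerivWithinAt.congr (fun t ht => V.total_zero θ ht)
    (V.total_zero θ ht)

/-- The radial component of the initial velocity. -/
def radial (θ t : ℝ) : ℝ :=
  V.partial_ (1, 0, 0) (0, θ, t) 0 * Real.cos θ + V.partial_ (1, 0, 0) (0, θ, t) 1 * Real.sin θ

/-- The angular component of the initial velocity. -/
def angular (θ t : ℝ) : ℝ :=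
  V.partial_ (1, 0, 0) (0, θ, t) 1 * Real.cos θ - V.partial_ (1, 0, 0) (0, θ, t) 0 * Real.sin θ

/-- The `θ`-derivative of the angular component of the initial velocity. -/
def angular' (θ t : ℝ) : ℝ :=
  fderiv ℝ (V.partial_ (1, 0, 0)) (0, θ, t) (0, 1, 0) 1 * Real.cos θ
    - fderiv ℝ (V.partial_ (1, 0, 0)) (0, θ, t) (0, 1, 0) 0 * Real.sin θ - V.radial θ t

/-- The `t`-derivative of the vertical component of the initial velocity. -/
def vertical' (θ t : ℝ) : ℝ := fderiv ℝ (V.partial_ (1, 0, 0)) (0, θ, t) (0, 0, 1) 2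

theorem continuous_radial : Continuous fun q : ℝ × ℝ => V.radial q.1 q.2 := by
  have h : Continuous (V.partial_ (1, 0, 0)) := (V.contDiff_partial _).continuous
  unfold radial
  fun_prop

theorem continuous_second (v : ℝ × ℝ × ℝ) :
    Continuous fun q : ℝ × ℝ => fderiv ℝ (V.partial_ (1, 0, 0)) (0, q.1, q.2) v := by
  have h : Continuous fun q => fderiv ℝ (V.partial_ (1, 0, 0)) q v :=
    (contDiff_fderiv_apply (V.contDiff_partial (1, 0, 0)) v).continuous
  exact h.comp (by fun_prop : Continuous fun q : ℝ × ℝ => ((0 : ℝ), q.1, q.2))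

theorem continuous_angular' : Continuous fun q : ℝ × ℝ => V.angular' q.1 q.2 := by
  have h := V.continuous_second (0, 1, 0)
  have h' := V.continuous_radial
  unfold angular'
  fun_prop

theorem continuous_vertical' : Continuous fun q : ℝ × ℝ => V.vertical' q.1 q.2 := by
  have h := V.continuous_second (0, 0, 1)
  unfold vertical'
  fun_prop

theorem hasDerivAt_angular (θ t : ℝ) :
    HasDerivAt (fun θ => V.angular θ t) (V.angular' θ t) θ := by
  have h := hasDerivAt_pi.1
    (hasDerivAt_slice₁ (V.differentiable_partial (1, 0, 0) (0, θ, t)))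
  refine (((h 1).fun_mul (Real.hasDerivAt_cos θ)).fun_sub
    ((h 0).fun_mul (Real.hasDerivAt_sin θ))).congr_deriv ?_
  unfold angular' radial
  ring

theorem partial_periodic (e θ t : ℝ) (v : ℝ × ℝ × ℝ) :
    V.partial_ v (e, θ + 2 * Real.pi, t) = V.partial_ v (e, θ, t) := by
  have h : V.total = fun q => V.total (q + ((0, 2 * Real.pi, 0) : ℝ × ℝ × ℝ)) := by
    funext q
    simp [total, V.periodic]
  unfold partial_
  conv_rhs => rw [h, fderiv_comp_add_right]
  simp

/-- The integrand is the θ-derivative of a 2π-periodic function. -/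
theorem integral_angular' (t : ℝ) : ∫ θ in (0 : ℝ)..(2 * Real.pi), V.angular' θ t = 0 := by
  rw [intervalIntegral.integral_eq_sub_of_hasDerivAt (f := fun θ => V.angular θ t)
    (fun θ _ => V.hasDerivAt_angular θ t)]
  · have h := V.partial_periodic 0 0 t (1, 0, 0)
    rw [zero_add] at h
    simp [angular, h]
  · exact (V.continuous_angular'.comp (by fun_prop : Continuous fun θ : ℝ => (θ, t))).intervalIntegrable
      _ _

/-- The boundary curves stay in their planes, so the vertical velocity is zero at both ends. -/
theorem integral_vertical' (θ : ℝ) : ∫ t in (0 : ℝ)..L, V.vertical' θ t = 0 := by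
  have h0 : (0 : ℝ) ∈ Ioo (-V.δ) V.δ := ⟨by linarith [V.δ_pos], V.δ_pos⟩
  have hd (t c : ℝ) (hc : ∀ e ∈ Ioo (-V.δ) V.δ, V.map e θ t 2 = c) :
      V.partial_ (1, 0, 0) (0, θ, t) 2 = 0 := by
    refine (hasDerivAt_pi.1 (hasDerivAt_slice₀ (V.differentiable_total (0, θ, t))) 2).unique ?_
    refine (hasDerivAt_const (0 : ℝ) c).congr_of_eventuallyEq ?_
    filter_upwards [isOpen_Ioo.mem_nhds h0] with e he
    exact hc e he
  rw [intervalIntegral.integral_eq_sub_of_hasDerivAt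
    (f := fun t => V.partial_ (1, 0, 0) (0, θ, t) 2) (f' := fun t => V.vertical' θ t)
    (fun t _ => hasDerivAt_pi.1 (hasDerivAt_slice₂ (V.differentiable_partial (1, 0, 0) (0, θ, t))) 2)]
  · rw [hd L L fun e he => V.upper e (abs_lt.2 he) θ, hd 0 0 fun e he => V.lower e (abs_lt.2 he) θ,
      sub_zero]
  · exact (V.continuous_vertical'.comp (by fun_prop : Continuous fun t : ℝ => (θ, t))).intervalIntegrable
      _ _

theorem areaSq_zero (hL : 0 < L) (τ θ : ℝ) {t : ℝ} (ht : t ∈ Icc 0 L) :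
    V.areaSq τ (0, θ, t) = (conf κ r * r) ^ 2 := by
  rw [areaSq, V.total_zero θ ht, V.partial_angle_zero θ ht, V.partial_height_zero hL θ ht,
    gram_cylinder]

/-- The coefficient of the radial velocity is the derivative of σr with respect to r. The rotating
frame moves one multiple of the radial velocity out of the angular derivative into this term. -/
theorem fderiv_areaSq_zero (hL : 0 < L) (h : 0 < 4 + κ * r ^ 2) (τ θ : ℝ) {t : ℝ}
    (ht : t ∈ Icc 0 L) :
    fderiv ℝ (V.areaSq τ) (0, θ, t) (1, 0, 0) =
      2 * (conf κ r * r) * ((conf κ r - κ / 2 * conf κ r ^ 2 * r ^ 2) * V.radial θ t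
        + conf κ r * V.angular' θ t + conf κ r * r * V.vertical' θ t) := by
  have h0 : (0 : ℝ) ∈ Ioo (-V.δ) V.δ := ⟨by linarith [V.δ_pos], V.δ_pos⟩
  have h1 := hasDerivAt_slice₀
    ((V.contDiffAt_areaSq τ (V.denom_pos h0 θ ht)).differentiableAt (by simp))
  have h2 := hasDerivAt_gram_cylinder (τ := τ) h
    (hasDerivAt_slice₀ (V.differentiable_total (0, θ, t)))
    (hasDerivAt_slice₀ (V.differentiable_partial (0, 1, 0) (0, θ, t)))
    (hasDerivAt_slice₀ (V.differentiable_partial (0, 0, 1) (0, θ, t)))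
    (V.total_zero θ ht) (V.partial_angle_zero θ ht) (V.partial_height_zero hL θ ht)
  rw [h1.unique h2]
  -- Mixed partials commute, so the ε-derivatives of the tangent vectors become derivatives of the
  -- velocity.
  have e1 : fderiv ℝ (V.partial_ (0, 1, 0)) (0, θ, t) (1, 0, 0) =
    fderiv ℝ (V.partial_ (1, 0, 0)) (0, θ, t) (0, 1, 0) := fderiv_fderiv_comm V.contDiff_total _ _ _
  have e2 : fderiv ℝ (V.partial_ (0, 0, 1)) (0, θ, t) (1, 0, 0) =
    fderiv ℝ (V.partial_ (1, 0, 0)) (0, θ, t) (0, 0, 1) := fderiv_fderiv_comm V.contDiff_total _ _ _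
  rw [e1, e2]
  unfold angular' vertical' radial partial_
  ring

theorem volumeDensity_zero (hL : 0 < L) (θ : ℝ) {t : ℝ} (ht : t ∈ Icc 0 L) :
    V.volumeDensity 0 θ t = conf κ r ^ 2 * r * V.radial θ t := by
  rw [volumeDensity, det_rows, V.total_zero θ ht, V.partial_angle_zero θ ht,
    V.partial_height_zero hL θ ht, sigma_cylinder, radial]
  simp
  ring

theorem integral_radial_eq_zero (hL : 0 < L) (hr : 0 < r) (h : 0 < 4 + κ * r ^ 2) {τ : ℝ}
    (hV : V.IsVolumePreserving τ) :
    ∫ θ in (0 : ℝ)..(2 * Real.pi), ∫ t in (0 : ℝ)..L, V.radial θ t = 0 := by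
  have hs : 0 < conf κ r := div_pos (by norm_num) h
  have hv := V.integral_volumeDensity_eq_zero hL hV
  have hcongr : ∀ θ, ∫ t in (0 : ℝ)..L, V.volumeDensity 0 θ t =
      conf κ r ^ 2 * r * ∫ t in (0 : ℝ)..L, V.radial θ t := fun θ => by
    rw [← intervalIntegral.integral_const_mul]
    refine intervalIntegral.integral_congr fun t ht => ?_
    rw [uIcc_of_le hL.le] at ht
    exact V.volumeDensity_zero hL θ ht
  simp only [hcongr, intervalIntegral.integral_const_mul] at hv
  exact (mul_eq_zero.1 hv).resolve_left (by positivity)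

theorem iterated_integral_angular' :
    ∫ θ in (0 : ℝ)..(2 * Real.pi), ∫ t in (0 : ℝ)..L, V.angular' θ t = 0 := by
  -- The θ-integral is the one that vanishes, so it has to become the inner one.
  rw [MeasureTheory.intervalIntegral_intervalIntegral_swap]
  · simp [V.integral_angular']
  · have h : ContinuousOn (Function.uncurry V.angular') (uIcc 0 (2 * Real.pi) ×ˢ uIcc 0 L) :=
      V.continuous_angular'.continuousOn
    have := h.integrableOn_compact (μ := MeasureTheory.volume) (isCompact_uIcc.prod isCompact_uIcc)
    exact this.mono_set (prod_mono uIoc_subset_uIcc uIoc_subset_uIcc)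

end AdmissibleVariation

/-- A circular cylinder between horizontal planes is a critical point of the area for
volume-preserving variations. -/
theorem isCapillary_cylinder {κ r L : ℝ} (τ : ℝ) (hL : 0 < L) (hr : 0 < r)
    (h : 0 < 4 + κ * r ^ 2) : IsCapillary κ τ L (Real.pi / 2) (cylinder r) := by
  intro V hV
  have hs : 0 < conf κ r := div_pos (by norm_num) h
  have hsr : 0 < conf κ r * r := mul_pos hs hr
  rw [AdmissibleVariation.energy_pi_div_two]
  refine (V.hasDerivAt_area hL τ fun θ t ht => ?_).congr_deriv ?_
  · rw [V.areaSq_zero hL τ θ ht]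
    positivity
  have hθ (f : ℝ → ℝ → ℝ) (hf : Continuous fun q : ℝ × ℝ => f q.1 q.2) (θ : ℝ) :
      IntervalIntegrable (fun t => f θ t) MeasureTheory.volume 0 L :=
    (hf.comp (by fun_prop : Continuous fun t : ℝ => (θ, t))).intervalIntegrable _ _
  have hI (f : ℝ → ℝ → ℝ) (hf : Continuous fun q : ℝ × ℝ => f q.1 q.2) (c : ℝ) :
      IntervalIntegrable (fun θ => c * ∫ t in (0 : ℝ)..L, f θ t) MeasureTheory.volume 0
        (2 * Real.pi) :=
    (continuous_const.mul (intervalIntegral.continuous_parametric_intervalIntegral_of_continuous'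
      hf 0 L)).intervalIntegrable _ _
  -- The factors are constant on the cylinder and leave the integral, so only the mean of the radial
  -- velocity matters. The vertical term already vanishes in the t-integral.
  have hinner (θ : ℝ) : ∫ t in (0 : ℝ)..L, fderiv ℝ (V.areaSq τ) (0, θ, t) (1, 0, 0) /
      (2 * Real.sqrt (V.areaSq τ (0, θ, t))) =
      (conf κ r - κ / 2 * conf κ r ^ 2 * r ^ 2) * (∫ t in (0 : ℝ)..L, V.radial θ t)
        + conf κ r * ∫ t in (0 : ℝ)..L, V.angular' θ t := by
    have hint : ∫ t in (0 : ℝ)..L, fderiv ℝ (V.areaSq τ) (0, θ, t) (1, 0, 0) /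
        (2 * Real.sqrt (V.areaSq τ (0, θ, t))) =
        ∫ t in (0 : ℝ)..L, ((conf κ r - κ / 2 * conf κ r ^ 2 * r ^ 2) * V.radial θ t
        + conf κ r * V.angular' θ t + conf κ r * r * V.vertical' θ t) := by
      refine intervalIntegral.integral_congr fun t ht => ?_
      rw [uIcc_of_le hL.le] at ht
      rw [V.fderiv_areaSq_zero hL h τ θ ht, V.areaSq_zero hL τ θ ht, Real.sqrt_sq hsr.le,
        mul_div_cancel_left₀ _ (by positivity)]
    have i1 := (hθ _ V.continuous_radial θ).const_mul (conf κ r - κ / 2 * conf κ r ^ 2 * r ^ 2)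
    have i2 := (hθ _ V.continuous_angular' θ).const_mul (conf κ r)
    have i3 := (hθ _ V.continuous_vertical' θ).const_mul (conf κ r * r)
    rw [hint, intervalIntegral.integral_add (i1.add i2) i3, intervalIntegral.integral_add i1 i2]
    simp only [intervalIntegral.integral_const_mul, V.integral_vertical' θ]
    ring
  simp only [hinner]
  rw [intervalIntegral.integral_add (hI _ V.continuous_radial _) (hI _ V.continuous_angular' _)]
  simp only [intervalIntegral.integral_const_mul, V.integral_radial_eq_zero hL hr h hV,
    V.iterated_integral_angular', mul_zero, add_zero]

end

section

open Set

/-! ### Rotationally symmetric variations -/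

/-- The coordinate radius of the disk about the origin of area `2 π w` in the base. -/
def radius (κ w : ℝ) : ℝ := Real.sqrt (4 * w / (2 - κ * w))

theorem radius_pos {κ w : ℝ} (h0 : 0 < w) (h1 : 0 < 2 - κ * w) : 0 < radius κ w :=
  Real.sqrt_pos.2 (by positivity)

theorem radius_sq {κ w : ℝ} (h0 : 0 < w) (h1 : 0 < 2 - κ * w) :
    radius κ w ^ 2 = 4 * w / (2 - κ * w) :=
  Real.sq_sqrt (by positivity)

theorem conf_radius {κ w : ℝ} (h0 : 0 < w) (h1 : 0 < 2 - κ * w) :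
    conf κ (radius κ w) = (2 - κ * w) / 2 := by
  have : 4 + κ * radius κ w ^ 2 = 8 / (2 - κ * w) := by
    rw [radius_sq h0 h1]
    field_simp
    ring
  rw [conf, this]
  field_simp
  norm_num

theorem hasDerivAt_radius {κ w : ℝ} (h0 : 0 < w) (h1 : 0 < 2 - κ * w) :
    HasDerivAt (radius κ) (4 / ((2 - κ * w) ^ 2 * radius κ w)) w := by
  have hn : HasDerivAt (fun w : ℝ => 4 * w) 4 w := by
    simpa using (hasDerivAt_id' w).const_mul 4
  have hd : HasDerivAt (fun w : ℝ => 2 - κ * w) (-κ) w := by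
    simpa using ((hasDerivAt_id' w).const_mul κ).const_sub 2
  have hu : 4 * w / (2 - κ * w) ≠ 0 := by positivity
  refine ((hn.fun_div hd h1.ne').sqrt hu).congr_deriv ?_
  have hp := (radius_pos h0 h1).ne'
  unfold radius at hp ⊢
  generalize Real.sqrt (4 * w / (2 - κ * w)) = R at hp
  have h1' := h1.ne'
  field_simp
  ring

theorem HasDerivAt.radius {κ x f' : ℝ} {f : ℝ → ℝ} (hf : HasDerivAt f f' x) (h0 : 0 < f x)
    (h1 : 0 < 2 - κ * f x) :
    HasDerivAt (fun x => radius κ (f x))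
      (4 / ((2 - κ * f x) ^ 2 * EKT.radius κ (f x)) * f') x :=
  (hasDerivAt_radius h0 h1).comp x hf

/-- This is dw = σ²R dR: the fraction is the derivative of the radius with respect to w. -/
theorem conf_sq_mul_radius {κ w : ℝ} (h0 : 0 < w) (h1 : 0 < 2 - κ * w) (w' : ℝ) :
    conf κ (radius κ w) ^ 2 * radius κ w * (4 / ((2 - κ * w) ^ 2 * radius κ w) * w') = w' := by
  rw [conf_radius h0 h1]
  have hp := (radius_pos h0 h1).ne'
  have h1' := h1.ne'
  field_simp
  ring

theorem radius_mem_model {κ w : ℝ} (h0 : 0 < w) (h1 : 0 < 2 - κ * w) (hκ : κ < 0) :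
    radius κ w ^ 2 < (2 / Real.sqrt (-κ)) ^ 2 := by
  rw [radius_sq h0 h1, div_pow, Real.sq_sqrt (by linarith), div_lt_div_iff₀ h1 (by linarith)]
  nlinarith

/-- The areas (over `2 π`) enclosed by the horizontal circles of the test variation. -/
def diskArea (w₀ η k e t : ℝ) : ℝ := w₀ + η * Real.sin e * Real.cos (k * t)

/-- The `t`-derivative of `diskArea`. -/
def diskSlope (η k e t : ℝ) : ℝ := -(η * k * Real.sin e * Real.sin (k * t))

theorem hasDerivAt_diskArea_left (w₀ η k e t : ℝ) :
    HasDerivAt (fun e => diskArea w₀ η k e t) (η * Real.cos e * Real.cos (k * t)) e :=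
  (((Real.hasDerivAt_sin e).const_mul η).mul_const _).const_add w₀

theorem hasDerivAt_mul_left (k t : ℝ) : HasDerivAt (fun t : ℝ => k * t) k t := by
  simpa using (hasDerivAt_id' t).const_mul k

theorem hasDerivAt_diskArea_right (w₀ η k e t : ℝ) :
    HasDerivAt (fun t => diskArea w₀ η k e t) (diskSlope η k e t) t := by
  refine (((hasDerivAt_mul_left k t).cos.const_mul (η * Real.sin e)).const_add w₀).congr_deriv ?_
  unfold diskSlope
  ring

/-- With sin ε in place of ε the bound holds for every ε. The family is then smooth for all
parameters, and the second ε-derivative of w at 0 is still zero. -/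
theorem abs_diskArea_sub_le {η : ℝ} (hη : 0 ≤ η) (k e t : ℝ) :
    |η * Real.sin e * Real.cos (k * t)| ≤ η := by
  rw [abs_mul, abs_mul, abs_of_nonneg hη]
  calc η * |Real.sin e| * |Real.cos (k * t)| ≤ η * 1 * 1 := by
        gcongr
        · exact Real.abs_sin_le_one e
        · exact Real.abs_cos_le_one _
    _ = η := by ring

/-- A surface of revolution about the `z`-axis. -/
def revolution (R : ℝ → ℝ) (θ t : ℝ) : E3 := ![R t * Real.cos θ, R t * Real.sin θ, t]

theorem sigma_revolution (κ : ℝ) (R : ℝ → ℝ) (θ t : ℝ) :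
    sigma κ (revolution R θ t) = conf κ (R t) :=
  sigma_cylinder κ (R t) θ t

theorem d₁_revolution (R : ℝ → ℝ) (θ t : ℝ) :
    d₁ (revolution R) θ t = ![-(R t * Real.sin θ), R t * Real.cos θ, 0] :=
  d₁_cylinder (R t) θ t

theorem d₂_revolution {R : ℝ → ℝ} {R' t : ℝ} (hR : HasDerivAt R R' t) (θ : ℝ) :
    d₂ (revolution R) θ t = ![R' * Real.cos θ, R' * Real.sin θ, 1] := by
  refine HasDerivAt.deriv ?_
  rw [hasDerivAt_pi]
  intro i
  fin_cases i
  · simpa [revolution] using hR.mul_const (Real.cos θ)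
  · simpa [revolution] using hR.mul_const (Real.sin θ)
  · simpa [revolution] using hasDerivAt_id' t

/-- In the frame of radial, angular and fibre directions, X_t = (σR', 0, 1) and X_θ = (0, σR,
−στR²); the three 2 × 2 minors give the formula. -/
theorem gram_revolution (κ τ : ℝ) {R : ℝ → ℝ} {R' t : ℝ} (hR : HasDerivAt R R' t) (θ : ℝ) :
    gram κ τ (revolution R θ t) (d₁ (revolution R) θ t) (d₂ (revolution R) θ t) =
      (conf κ (R t) * R t) ^ 2 + (1 + τ ^ 2 * R t ^ 2) * (conf κ (R t) ^ 2 * R t * R') ^ 2 := by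
  have hcs := Real.sin_sq_add_cos_sq θ
  rw [d₁_revolution, d₂_revolution hR]
  simp only [gram, metric, sigma_revolution]
  simp [revolution]
  generalize conf κ (R t) = s
  generalize R t = R
  generalize Real.cos θ = c at *
  generalize Real.sin θ = d at *
  have e1 : R * d * (R * d) + R * c * (R * c) = R ^ 2 := by linear_combination R ^ 2 * hcs
  have e2 : R' * c * (R' * c) + R' * d * (R' * d) = R' ^ 2 := by linear_combination R' ^ 2 * hcs
  have e3 : -(R * d * (R * d)) - R * c * (R * c) = -R ^ 2 := by linear_combination -R ^ 2 * hcs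
  have e4 : R * d * (R' * c) - R * c * (R' * d) = 0 := by ring
  have e5 : -(R * d * (R' * c)) + R * c * (R' * d) = 0 := by ring
  rw [e1, e2, e3, e4, e5]
  ring

theorem velocity_revolution {R : ℝ → ℝ → ℝ} {R' e t : ℝ} (hR : HasDerivAt (fun e => R e t) R' e)
    (θ : ℝ) : velocity (fun e => revolution (R e)) e θ t =
      ![R' * Real.cos θ, R' * Real.sin θ, 0] := by
  refine HasDerivAt.deriv ?_
  rw [hasDerivAt_pi]
  intro i
  fin_cases i
  · simpa [revolution] using hR.mul_const (Real.cos θ)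
  · simpa [revolution] using hR.mul_const (Real.sin θ)
  · simpa [revolution] using hasDerivAt_const e t

theorem volume_revolution (κ τ : ℝ) {R : ℝ → ℝ → ℝ} {R' R₂ e t : ℝ}
    (hR : HasDerivAt (fun e => R e t) R' e) (hR₂ : HasDerivAt (R e) R₂ t) (θ : ℝ) :
    volDensity κ τ (revolution (R e) θ t) *
      Matrix.det (Matrix.of ![velocity (fun e => revolution (R e)) e θ t,
        d₁ (revolution (R e)) θ t, d₂ (revolution (R e)) θ t]) =
      conf κ (R e t) ^ 2 * R e t * R' := by
  rw [volDensity_eq, sigma_revolution, det_rows, velocity_revolution hR, d₁_revolution,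
    d₂_revolution hR₂]
  simp
  linear_combination conf κ (R e t) ^ 2 * R e t * R' * Real.sin_sq_add_cos_sq θ

theorem contDiffAt_radius {κ w : ℝ} (h0 : 0 < w) (h1 : 0 < 2 - κ * w) :
    ContDiffAt ℝ ∞ (radius κ) w := by
  have hd : ContDiffAt ℝ ∞ (fun w : ℝ => 4 * w / (2 - κ * w)) w :=
    ContDiffAt.div (by fun_prop) (by fun_prop) h1.ne'
  exact hd.sqrt (by positivity)

/-- The rotationally symmetric variation whose horizontal circle at height `t` encloses the area
`2 π (w₀ + η sin ε cos (π t / L))`. -/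
def rotationalVariation {κ r L w₀ η : ℝ} (hη : 0 ≤ η)
    (hw : ∀ x, |x| ≤ η → 0 < w₀ + x ∧ 0 < 2 - κ * (w₀ + x)) (hr : radius κ w₀ = r) :
    AdmissibleVariation κ L (cylinder r) where
  map e := revolution fun t => radius κ (diskArea w₀ η (Real.pi / L) e t)
  -- Any positive number would do, since all bounds are uniform in ε.
  δ := 1
  δ_pos := one_pos
  smooth := by
    have hR : ContDiff ℝ ∞ fun q : ℝ × ℝ × ℝ =>
        radius κ (diskArea w₀ η (Real.pi / L) q.1 q.2.2) := by
      rw [contDiff_iff_contDiffAt]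
      intro q
      have h := hw _ (abs_diskArea_sub_le hη (Real.pi / L) q.1 q.2.2)
      refine ContDiffAt.comp (g := radius κ) q (contDiffAt_radius h.1 h.2) ?_
      unfold diskArea
      fun_prop
    rw [contDiff_pi]
    intro i
    fin_cases i
    · simp only [revolution]
      exact hR.mul (by fun_prop)
    · simp only [revolution]
      exact hR.mul (by fun_prop)
    · simp only [revolution]
      exact contDiff_snd.comp contDiff_snd
  periodic e θ t := by simp [revolution]
  map_zero θ t _ := by simp [revolution, cylinder, diskArea, hr]
  mem_model e _ θ t _ := by
    intro hκ
    have h := hw _ (abs_diskArea_sub_le hη (Real.pi / L) e t)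
    refine lt_of_eq_of_lt ?_ (radius_mem_model h.1 h.2 hκ)
    simp only [revolution, Matrix.cons_val_zero, Matrix.cons_val_one, diskArea]
    linear_combination
      radius κ (w₀ + η * Real.sin e * Real.cos (Real.pi / L * t)) ^ 2 * Real.sin_sq_add_cos_sq θ
  lower e _ θ := rfl
  upper e _ θ := rfl
  interior e _ θ t ht := ht

section

variable {κ r L w₀ η : ℝ} (hη : 0 ≤ η)
  (hw : ∀ x, |x| ≤ η → 0 < w₀ + x ∧ 0 < 2 - κ * (w₀ + x)) (hr : radius κ w₀ = r)

/-- The density of the swept volume is exactly the ε-derivative of w, whose integral over [0, L]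
vanishes for every ε; no higher-order correction of the family is needed. -/
theorem rotationalVariation_isVolumePreserving (hL : 0 < L) (τ : ℝ) :
    (rotationalVariation (L := L) hη hw hr).IsVolumePreserving τ := by
  intro ε _
  have hden (e θ t : ℝ) : volDensity κ τ ((rotationalVariation (L := L) hη hw hr).map e θ t) *
      Matrix.det (Matrix.of ![velocity (rotationalVariation (L := L) hη hw hr).map e θ t,
        d₁ ((rotationalVariation (L := L) hη hw hr).map e) θ t,
        d₂ ((rotationalVariation (L := L) hη hw hr).map e) θ t]) =
      η * Real.cos e * Real.cos (Real.pi / L * t) := by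
    obtain ⟨h0, h1⟩ := hw _ (abs_diskArea_sub_le hη (Real.pi / L) e t)
    change 0 < diskArea w₀ η (Real.pi / L) e t at h0
    change 0 < 2 - κ * diskArea w₀ η (Real.pi / L) e t at h1
    have hre := HasDerivAt.radius (hasDerivAt_diskArea_left w₀ η (Real.pi / L) e t) h0 h1
    have hrt := HasDerivAt.radius (hasDerivAt_diskArea_right w₀ η (Real.pi / L) e t) h0 h1
    exact (volume_revolution κ τ
      (R := fun e t => radius κ (diskArea w₀ η (Real.pi / L) e t)) hre hrt θ).trans
      (conf_sq_mul_radius h0 h1 _)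
  simp only [volumeChange, hden]
  have hz : ∫ t in (0 : ℝ)..L, Real.cos (Real.pi / L * t) = 0 := by
    rw [intervalIntegral.integral_comp_mul_left (fun x => Real.cos x) (by positivity)]
    simp [hL.ne']
  simp [intervalIntegral.integral_const_mul, hz]

end

end

/-! ### Second variation of the area along the test family -/

section

open Set

/-- The function `P(w)` in the squared area element `w (2 - κ w) + P(w) w_t²`. -/
def slopeCoeff (κ τ w : ℝ) : ℝ := 1 + 4 * τ ^ 2 * w / (2 - κ * w)

/-- The squared area element of the test variation. -/
def testDensity (κ τ w₀ η k e t : ℝ) : ℝ :=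
  diskArea w₀ η k e t * (2 - κ * diskArea w₀ η k e t)
    + slopeCoeff κ τ (diskArea w₀ η k e t) * diskSlope η k e t ^ 2

/-- The first `ε`-derivative of `testDensity`. -/
def testDensity' (κ τ w₀ η k e t : ℝ) : ℝ :=
  (2 - 2 * κ * diskArea w₀ η k e t) * (η * Real.cos e * Real.cos (k * t))
    + 8 * τ ^ 2 / (2 - κ * diskArea w₀ η k e t) ^ 2 * (η * Real.cos e * Real.cos (k * t))
      * diskSlope η k e t ^ 2
    + 2 * slopeCoeff κ τ (diskArea w₀ η k e t) * diskSlope η k e t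
      * -(η * k * Real.cos e * Real.sin (k * t))

/-- The second `ε`-derivative of `testDensity`. -/
def testDensity'' (κ τ w₀ η k e t : ℝ) : ℝ :=
  -2 * κ * (η * Real.cos e * Real.cos (k * t)) ^ 2
    + (2 - 2 * κ * diskArea w₀ η k e t) * -(η * Real.sin e * Real.cos (k * t))
    + 16 * τ ^ 2 * κ / (2 - κ * diskArea w₀ η k e t) ^ 3
      * (η * Real.cos e * Real.cos (k * t)) ^ 2 * diskSlope η k e t ^ 2
    + 8 * τ ^ 2 / (2 - κ * diskArea w₀ η k e t) ^ 2 * -(η * Real.sin e * Real.cos (k * t))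
      * diskSlope η k e t ^ 2
    + 4 * (8 * τ ^ 2 / (2 - κ * diskArea w₀ η k e t) ^ 2) * (η * Real.cos e * Real.cos (k * t))
      * diskSlope η k e t * -(η * k * Real.cos e * Real.sin (k * t))
    + 2 * slopeCoeff κ τ (diskArea w₀ η k e t) * (η * k * Real.cos e * Real.sin (k * t)) ^ 2
    - 2 * slopeCoeff κ τ (diskArea w₀ η k e t) * diskSlope η k e t ^ 2

section

variable {κ r L w₀ η k : ℝ}

theorem hasDerivAt_diskSlope (η k e t : ℝ) :
    HasDerivAt (fun e => diskSlope η k e t) (-(η * k * Real.cos e * Real.sin (k * t))) e :=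
  (((Real.hasDerivAt_sin e).const_mul (η * k)).mul_const _).fun_neg

theorem hasDerivAt_two_sub {w' e : ℝ} {f : ℝ → ℝ} (κ : ℝ) (hf : HasDerivAt f w' e) : HasDerivAt (fun e => 2 - κ * f e) (-(κ * w')) e :=
  (hf.const_mul κ).const_sub 2

theorem HasDerivAt.slopeCoeff {w' e : ℝ} {f : ℝ → ℝ} {κ : ℝ} (τ : ℝ) (hf : HasDerivAt f w' e)
    (h : 0 < 2 - κ * f e) :
    HasDerivAt (fun e => slopeCoeff κ τ (f e)) (8 * τ ^ 2 / (2 - κ * f e) ^ 2 * w') e := by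
  refine (((hf.const_mul (4 * τ ^ 2)).fun_div (hasDerivAt_two_sub κ hf) h.ne').const_add
    1).congr_deriv ?_
  have h' := h.ne'
  field_simp
  ring

theorem hasDerivAt_testDensity (τ t : ℝ) {e : ℝ} (h : 0 < 2 - κ * diskArea w₀ η k e t) :
    HasDerivAt (fun e => testDensity κ τ w₀ η k e t) (testDensity' κ τ w₀ η k e t) e := by
  have hw := hasDerivAt_diskArea_left w₀ η k e t
  have hy := hasDerivAt_diskSlope η k e t
  refine ((hw.fun_mul (hasDerivAt_two_sub κ hw)).fun_add
    ((HasDerivAt.slopeCoeff τ hw h).fun_mul (hy.fun_pow 2))).congr_deriv ?_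
  simp only [Nat.cast_ofNat, Nat.add_one_sub_one, pow_one]
  unfold testDensity'
  ring

theorem hasDerivAt_testDensity' (τ t : ℝ) {e : ℝ} (h : 0 < 2 - κ * diskArea w₀ η k e t) :
    HasDerivAt (fun e => testDensity' κ τ w₀ η k e t) (testDensity'' κ τ w₀ η k e t) e := by
  have hw := hasDerivAt_diskArea_left w₀ η k e t
  have hy := hasDerivAt_diskSlope η k e t
  have hw₁ : HasDerivAt (fun e => η * Real.cos e * Real.cos (k * t))
      (-(η * Real.sin e * Real.cos (k * t))) e :=
    (((Real.hasDerivAt_cos e).const_mul η).mul_const _).congr_deriv (by ring)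
  have hy₁ : HasDerivAt (fun e => -(η * k * Real.cos e * Real.sin (k * t)))
      (-diskSlope η k e t) e := by
    refine (((Real.hasDerivAt_cos e).const_mul (η * k)).mul_const _).fun_neg.congr_deriv ?_
    unfold diskSlope
    ring
  have hP := HasDerivAt.slopeCoeff τ hw h
  have hP₁ : HasDerivAt (fun e => 8 * τ ^ 2 / (2 - κ * diskArea w₀ η k e t) ^ 2)
      (16 * τ ^ 2 * κ / (2 - κ * diskArea w₀ η k e t) ^ 3
        * (η * Real.cos e * Real.cos (k * t))) e := by
    refine ((hasDerivAt_const e (8 * τ ^ 2)).fun_div ((hasDerivAt_two_sub κ hw).fun_pow 2)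
      (pow_ne_zero 2 h.ne')).congr_deriv ?_
    have h' := h.ne'
    field_simp
    ring
  have hA := ((hw.const_mul (2 * κ)).const_sub 2).fun_mul hw₁
  refine ((hA.fun_add ((hP₁.fun_mul hw₁).fun_mul (hy.fun_pow 2))).fun_add
    (((hP.const_mul 2).fun_mul hy).fun_mul hy₁)).congr_deriv ?_
  simp only [Nat.cast_ofNat, Nat.add_one_sub_one, pow_one]
  unfold testDensity''
  ring

theorem diskArea_pos (hη : 0 ≤ η)
    (hw : ∀ x, |x| ≤ η → 0 < w₀ + x ∧ 0 < 2 - κ * (w₀ + x)) (k e t : ℝ) :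
    0 < diskArea w₀ η k e t :=
  (hw _ (abs_diskArea_sub_le hη k e t)).1

theorem two_sub_diskArea_pos (hη : 0 ≤ η)
    (hw : ∀ x, |x| ≤ η → 0 < w₀ + x ∧ 0 < 2 - κ * (w₀ + x)) (k e t : ℝ) :
    0 < 2 - κ * diskArea w₀ η k e t :=
  (hw _ (abs_diskArea_sub_le hη k e t)).2

theorem testDensity_pos (hη : 0 ≤ η)
    (hw : ∀ x, |x| ≤ η → 0 < w₀ + x ∧ 0 < 2 - κ * (w₀ + x)) (τ k e t : ℝ) :
    0 < testDensity κ τ w₀ η k e t := by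
  have h0 := diskArea_pos hη hw k e t
  have h1 := two_sub_diskArea_pos hη hw k e t
  unfold testDensity slopeCoeff
  positivity

theorem continuous_diskArea (w₀ η k : ℝ) :
    Continuous fun q : ℝ × ℝ × ℝ => diskArea w₀ η k q.1 q.2.2 := by
  unfold diskArea
  fun_prop

theorem continuous_diskSlope (η k : ℝ) :
    Continuous fun q : ℝ × ℝ × ℝ => diskSlope η k q.1 q.2.2 := by
  unfold diskSlope
  fun_prop

theorem continuous_slopeCoeff (hη : 0 ≤ η)
    (hw : ∀ x, |x| ≤ η → 0 < w₀ + x ∧ 0 < 2 - κ * (w₀ + x)) (τ k : ℝ) :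
    Continuous fun q : ℝ × ℝ × ℝ => slopeCoeff κ τ (diskArea w₀ η k q.1 q.2.2) := by
  have h := continuous_diskArea w₀ η k
  exact continuous_const.add ((continuous_const.mul h).div
    (continuous_const.sub (continuous_const.mul h))
    fun q => (two_sub_diskArea_pos hη hw k q.1 q.2.2).ne')

theorem continuous_const_div_pow (hη : 0 ≤ η)
    (hw : ∀ x, |x| ≤ η → 0 < w₀ + x ∧ 0 < 2 - κ * (w₀ + x)) (k c : ℝ) (n : ℕ) :
    Continuous fun q : ℝ × ℝ × ℝ => c / (2 - κ * diskArea w₀ η k q.1 q.2.2) ^ n := by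
  have h := continuous_diskArea w₀ η k
  exact continuous_const.div ((continuous_const.sub (continuous_const.mul h)).pow n)
    fun q => pow_ne_zero n (two_sub_diskArea_pos hη hw k q.1 q.2.2).ne'

theorem continuous_testDensity (hη : 0 ≤ η)
    (hw : ∀ x, |x| ≤ η → 0 < w₀ + x ∧ 0 < 2 - κ * (w₀ + x)) (τ k : ℝ) :
    Continuous fun q : ℝ × ℝ × ℝ => testDensity κ τ w₀ η k q.1 q.2.2 := by
  have h := continuous_diskArea w₀ η k
  have hy := continuous_diskSlope η k
  have hP := continuous_slopeCoeff hη hw τ k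
  unfold testDensity
  fun_prop

theorem continuous_testDensity' (hη : 0 ≤ η)
    (hw : ∀ x, |x| ≤ η → 0 < w₀ + x ∧ 0 < 2 - κ * (w₀ + x)) (τ k : ℝ) :
    Continuous fun q : ℝ × ℝ × ℝ => testDensity' κ τ w₀ η k q.1 q.2.2 := by
  have h := continuous_diskArea w₀ η k
  have hy := continuous_diskSlope η k
  have hP := continuous_slopeCoeff hη hw τ k
  have hP₁ := continuous_const_div_pow hη hw k (8 * τ ^ 2) 2
  unfold testDensity'
  fun_prop

theorem continuous_testDensity'' (hη : 0 ≤ η)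
    (hw : ∀ x, |x| ≤ η → 0 < w₀ + x ∧ 0 < 2 - κ * (w₀ + x)) (τ k : ℝ) :
    Continuous fun q : ℝ × ℝ × ℝ => testDensity'' κ τ w₀ η k q.1 q.2.2 := by
  have h := continuous_diskArea w₀ η k
  have hy := continuous_diskSlope η k
  have hP := continuous_slopeCoeff hη hw τ k
  have hP₁ := continuous_const_div_pow hη hw k (8 * τ ^ 2) 2
  have hP₂ := continuous_const_div_pow hη hw k (16 * τ ^ 2 * κ) 3
  unfold testDensity''
  fun_prop

/-- The second `ε`-derivative of the area element of the test variation. -/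
def areaSecond (κ τ w₀ η k e t : ℝ) : ℝ :=
  testDensity'' κ τ w₀ η k e t / (2 * Real.sqrt (testDensity κ τ w₀ η k e t))
    - testDensity' κ τ w₀ η k e t ^ 2
      / (4 * testDensity κ τ w₀ η k e t * Real.sqrt (testDensity κ τ w₀ η k e t))

theorem hasDerivAt_areaFirst (hη : 0 ≤ η)
    (hw : ∀ x, |x| ≤ η → 0 < w₀ + x ∧ 0 < 2 - κ * (w₀ + x)) (τ k e t : ℝ) :
    HasDerivAt (fun e => testDensity' κ τ w₀ η k e t /
      (2 * Real.sqrt (testDensity κ τ w₀ η k e t))) (areaSecond κ τ w₀ η k e t) e := by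
  have hpos := testDensity_pos hη hw τ k e t
  have h1 := hasDerivAt_testDensity τ t (two_sub_diskArea_pos hη hw k e t)
  have h2 := hasDerivAt_testDensity' τ t (two_sub_diskArea_pos hη hw k e t)
  have hs := Real.sqrt_pos.2 hpos
  refine (h2.fun_div ((h1.sqrt hpos.ne').const_mul 2) (by positivity)).congr_deriv ?_
  have hsq := Real.sq_sqrt hpos.le
  unfold areaSecond
  generalize Real.sqrt (testDensity κ τ w₀ η k e t) = s at *
  rw [← hsq]
  field_simp
  ring

/-- Second derivative of the area along the test variation. -/
theorem iteratedDeriv_two_integral (hη : 0 ≤ η)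
    (hw : ∀ x, |x| ≤ η → 0 < w₀ + x ∧ 0 < 2 - κ * (w₀ + x))
    (hL : 0 < L) (τ k : ℝ) :
    iteratedDeriv 2 (fun e => ∫ _ in (0 : ℝ)..(2 * Real.pi), ∫ t in (0 : ℝ)..L,
      Real.sqrt (testDensity κ τ w₀ η k e t)) 0 =
      ∫ _ in (0 : ℝ)..(2 * Real.pi), ∫ t in (0 : ℝ)..L, areaSecond κ τ w₀ η k 0 t := by
  have c0 := continuous_testDensity hη hw τ k
  have c1 := continuous_testDensity' hη hw τ k
  have c2 := continuous_testDensity'' hη hw τ k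
  have hpos (q : ℝ × ℝ × ℝ) := testDensity_pos hη hw τ k q.1 q.2.2
  have hs (q : ℝ × ℝ × ℝ) := Real.sqrt_pos.2 (hpos q)
  have k0 := c0.sqrt
  have k1 := c1.div (continuous_const.mul k0) fun q => (mul_pos two_pos (hs q)).ne'
  have k2 := (c2.div (continuous_const.mul k0) fun q => (mul_pos two_pos (hs q)).ne').sub
    ((c1.pow 2).div ((continuous_const.mul c0).mul k0)
      fun q => (mul_pos (mul_pos four_pos (hpos q)) (hs q)).ne')
  -- The first derivative is needed as a function of e, so the window |e| + 1 is chosen to contain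
  -- the given point.
  have d1 (e : ℝ) := hasDerivAt_iterated_integral (δ := |e| + 1) Real.two_pi_pos.le hL.le
    (fun e _ t => Real.sqrt (testDensity κ τ w₀ η k e t))
    (fun e _ t => testDensity' κ τ w₀ η k e t / (2 * Real.sqrt (testDensity κ τ w₀ η k e t)))
    k0.continuousOn k1.continuousOn (fun e _ _ _ t _ =>
      (hasDerivAt_testDensity τ t (two_sub_diskArea_pos hη hw k e t)).sqrt
        (testDensity_pos hη hw τ k e t).ne')
    (e := e) (abs_lt.1 (lt_add_one _))
  have d2 := hasDerivAt_iterated_integral (δ := 1) Real.two_pi_pos.le hL.le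
    (fun e _ t => testDensity' κ τ w₀ η k e t / (2 * Real.sqrt (testDensity κ τ w₀ η k e t)))
    (fun e _ t => areaSecond κ τ w₀ η k e t)
    k1.continuousOn k2.continuousOn (fun e _ _ _ t _ => hasDerivAt_areaFirst hη hw τ k e t)
    (e := 0) (by norm_num)
  rw [iteratedDeriv_succ, iteratedDeriv_one, funext fun e => (d1 e).deriv]
  exact d2.deriv

/-- At ε = 0 both w_t and the second ε-derivative of w vanish, which leaves the squares of the
first-order terms. The curvature disappears from the numerator of the cosine term because κw(2 − κw)
+ (1 − κw)² = 1. -/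
theorem areaSecond_zero (κ τ k η t : ℝ) (h0 : 0 < w₀) (h1 : 0 < 2 - κ * w₀) :
    areaSecond κ τ w₀ η k 0 t =
      η ^ 2 / Real.sqrt (w₀ * (2 - κ * w₀)) * (slopeCoeff κ τ w₀ * k ^ 2 * Real.sin (k * t) ^ 2
        - 1 / (w₀ * (2 - κ * w₀)) * Real.cos (k * t) ^ 2) := by
  have hs : 0 < Real.sqrt (w₀ * (2 - κ * w₀)) := Real.sqrt_pos.2 (by positivity)
  unfold areaSecond testDensity testDensity' testDensity''
  simp [diskArea, diskSlope]
  generalize Real.sqrt (w₀ * (2 - κ * w₀)) = s at *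
  have h1' := h1.ne'
  field_simp
  ring

theorem integral_sin_sq_sub_cos_sq (hL : 0 < L) (A B : ℝ) :
    ∫ t in (0 : ℝ)..L, (A * Real.sin (Real.pi / L * t) ^ 2
      - B * Real.cos (Real.pi / L * t) ^ 2) = (A - B) / 2 * L := by
  have hk : 0 < Real.pi / L := by positivity
  have hd (t : ℝ) : HasDerivAt (fun t => (A - B) / 2 * t
      - (A + B) / (2 * (Real.pi / L)) * (Real.sin (Real.pi / L * t) * Real.cos (Real.pi / L * t)))
      (A * Real.sin (Real.pi / L * t) ^ 2 - B * Real.cos (Real.pi / L * t) ^ 2) t := by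
    have hm := hasDerivAt_mul_left (Real.pi / L) t
    refine ((hasDerivAt_mul_left ((A - B) / 2) t).fun_sub
      ((hm.sin.fun_mul hm.cos).const_mul _)).congr_deriv ?_
    have hcs := Real.sin_sq_add_cos_sq (Real.pi / L * t)
    generalize Real.pi / L = k at *
    field_simp
    linear_combination (B - A) * hcs
  rw [intervalIntegral.integral_eq_sub_of_hasDerivAt (fun t _ => hd t)
    (Continuous.intervalIntegrable (by fun_prop) _ _)]
  rw [div_mul_cancel₀ _ hL.ne']
  simp

theorem iteratedDeriv_two_integral_neg (hη' : 0 < η)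
    (hw : ∀ x, |x| ≤ η → 0 < w₀ + x ∧ 0 < 2 - κ * (w₀ + x)) (hL : 0 < L) (τ : ℝ)
    (hlt : slopeCoeff κ τ w₀ * (Real.pi / L) ^ 2 * (w₀ * (2 - κ * w₀)) < 1) :
    iteratedDeriv 2 (fun e => ∫ _ in (0 : ℝ)..(2 * Real.pi), ∫ t in (0 : ℝ)..L,
      Real.sqrt (testDensity κ τ w₀ η (Real.pi / L) e t)) 0 < 0 := by
  have h := hw 0 (by simpa using hη'.le)
  rw [add_zero] at h
  have hG : 0 < w₀ * (2 - κ * w₀) := mul_pos h.1 h.2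
  rw [iteratedDeriv_two_integral hη'.le hw hL]
  simp only [areaSecond_zero κ τ _ η _ h.1 h.2, intervalIntegral.integral_const_mul,
    integral_sin_sq_sub_cos_sq hL, intervalIntegral.integral_const, sub_zero, smul_eq_mul]
  have h1 : slopeCoeff κ τ w₀ * (Real.pi / L) ^ 2 < 1 / (w₀ * (2 - κ * w₀)) := by
    rwa [lt_div_iff₀ hG]
  have h2 : (slopeCoeff κ τ w₀ * (Real.pi / L) ^ 2 - 1 / (w₀ * (2 - κ * w₀))) / 2 * L < 0 :=
    mul_neg_of_neg_of_pos (by linarith) hL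
  refine lt_of_eq_of_lt ?_ (mul_neg_of_pos_of_neg
    (div_pos (pow_pos hη' 2) (Real.sqrt_pos.2 hG)) (mul_neg_of_pos_of_neg Real.two_pi_pos h2))
  ring

theorem area_rotationalVariation (hη : 0 ≤ η)
    (hw : ∀ x, |x| ≤ η → 0 < w₀ + x ∧ 0 < 2 - κ * (w₀ + x))
    (hr : radius κ w₀ = r) (τ e : ℝ) :
    area κ τ L ((rotationalVariation (L := L) hη hw hr).map e) =
      ∫ _ in (0 : ℝ)..(2 * Real.pi), ∫ t in (0 : ℝ)..L,
        Real.sqrt (testDensity κ τ w₀ η (Real.pi / L) e t) := by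
  have hpt (θ t : ℝ) : gram κ τ
      (revolution (fun t => radius κ (diskArea w₀ η (Real.pi / L) e t)) θ t)
      (d₁ (revolution fun t => radius κ (diskArea w₀ η (Real.pi / L) e t)) θ t)
      (d₂ (revolution fun t => radius κ (diskArea w₀ η (Real.pi / L) e t)) θ t) =
      testDensity κ τ w₀ η (Real.pi / L) e t := by
    have h0 := diskArea_pos hη hw (Real.pi / L) e t
    have h1 := two_sub_diskArea_pos hη hw (Real.pi / L) e t
    rw [gram_revolution κ τ
      (HasDerivAt.radius (hasDerivAt_diskArea_right w₀ η (Real.pi / L) e t) h0 h1) θ,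
      conf_sq_mul_radius h0 h1, mul_pow, radius_sq h0 h1, conf_radius h0 h1, testDensity,
      slopeCoeff]
    have h1' := h1.ne'
    field_simp
    ring
  exact intervalIntegral.integral_congr fun θ _ => intervalIntegral.integral_congr fun t _ =>
    congrArg Real.sqrt (hpt θ t)

/-- A circular cylinder longer than half its critical length is unstable. -/
theorem not_isStable_cylinder {κ r L : ℝ} (τ : ℝ) (hL : 0 < L) (hr : 0 < r)
    (h : 0 < 4 + κ * r ^ 2)
    (hlt : Real.pi * (conf κ r * r) * Real.sqrt (1 + τ ^ 2 * r ^ 2) < L) :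
    ¬ IsStable κ τ L (Real.pi / 2) (cylinder r) := by
  -- This is the area of the disk of coordinate radius r divided by 2π, obtained by solving r² =
  -- 4w/(2 − κw) for w.
  obtain ⟨w₀, hw₀⟩ : ∃ w₀, w₀ = 2 * r ^ 2 / (4 + κ * r ^ 2) := ⟨_, rfl⟩
  have h0 : 0 < w₀ := by rw [hw₀]; positivity
  have h2 : 2 - κ * w₀ = 8 / (4 + κ * r ^ 2) := by
    rw [hw₀]
    field_simp
    ring
  have h1 : 0 < 2 - κ * w₀ := by rw [h2]; positivity
  have hrw : 4 * w₀ / (2 - κ * w₀) = r ^ 2 := by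
    rw [h2, hw₀]
    generalize 4 + κ * r ^ 2 = D at h
    field_simp
    norm_num
  have hrad : radius κ w₀ = r := by rw [radius, hrw, Real.sqrt_sq hr.le]
  -- The amplitude only has to keep w in the open range where the radius is defined and positive.
  obtain ⟨η, hη, hw⟩ : ∃ η > 0, ∀ x, |x| ≤ η → 0 < w₀ + x ∧ 0 < 2 - κ * (w₀ + x) := by
    have c1 : ContinuousAt (fun x : ℝ => w₀ + x) 0 := by fun_prop
    have c2 : ContinuousAt (fun x : ℝ => 2 - κ * (w₀ + x)) 0 := by fun_prop
    have hev := (c1.eventually_const_lt (u := 0) (by simpa using h0)).and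
      (c2.eventually_const_lt (u := 0) (by simpa using h1))
    obtain ⟨η, hη, hball⟩ := Metric.eventually_nhds_iff.1 hev
    exact ⟨η / 2, half_pos hη, fun x hx => hball (by
      rw [Real.dist_eq, sub_zero]; linarith)⟩
  intro hst
  have hV := hst (rotationalVariation hη.le hw hrad)
    (rotationalVariation_isVolumePreserving hη.le hw hrad hL τ)
  rw [AdmissibleVariation.energy_pi_div_two,
    funext fun e => area_rotationalVariation hη.le hw hrad τ e] at hV
  refine absurd (iteratedDeriv_two_integral_neg hη hw hL τ ?_) (not_lt.2 hV)
  have hP : slopeCoeff κ τ w₀ = 1 + τ ^ 2 * r ^ 2 := by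
    rw [← hrw, slopeCoeff]
    ring
  have hG : w₀ * (2 - κ * w₀) = (conf κ r * r) ^ 2 := by
    rw [h2, hw₀, conf]
    field_simp
    norm_num
  have hs : 0 < conf κ r := div_pos (by norm_num) h
  have hsq : (Real.pi * (conf κ r * r) * Real.sqrt (1 + τ ^ 2 * r ^ 2)) ^ 2 < L ^ 2 :=
    pow_lt_pow_left₀ hlt (by positivity) two_ne_zero
  rw [mul_pow, Real.sq_sqrt (by positivity)] at hsq
  rw [hP, hG, div_pow]
  have e : (1 + τ ^ 2 * r ^ 2) * (Real.pi ^ 2 / L ^ 2) * (conf κ r * r) ^ 2 =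
      (Real.pi * (conf κ r * r)) ^ 2 * (1 + τ ^ 2 * r ^ 2) / L ^ 2 := by ring
  rw [e, div_lt_one (by positivity)]
  exact hsq

end

end

end EKT

end

theorem theorem1p3 (κ τ r ρ L : ℝ) (hr : 0 < r)
    (hdisk : κ < 0 → r < 2 / Real.sqrt (-κ))
    (hρ : ρ = EKT.circleRadius κ r)
    (hL : 0 < L)
    (hfib : 0 < κ → 0 < τ → L < 8 * τ * Real.pi / κ) :
    -- along its boundary the cylinder meets the planes z = 0 and z = L orthogonally,
    -- the Robin coefficient vanishes and the Robin condition is the Neumann condition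
    (∀ c, c = 0 ∨ c = L → ∀ θ : ℝ, ∀ N M : EKT.E3,
      EKT.IsUnitNormal κ τ (EKT.cylinder r) θ c N →
      EKT.IsUnitNormal κ τ (EKT.plane c) (r * Real.cos θ) (r * Real.sin θ) M →
        EKT.metric κ τ (EKT.cylinder r θ c) N M = 0 ∧
        ∀ ξ η : ℝ × ℝ,
          EKT.IsUnitConormal κ τ (EKT.cylinder r) θ c
            (EKT.d₁ (EKT.cylinder r) θ c) ξ →
          EKT.IsUnitConormal κ τ (EKT.plane c) (r * Real.cos θ) (r * Real.sin θ)
            (EKT.d₁ (EKT.cylinder r) θ c) η →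
            EKT.robinCoeff κ τ (EKT.cylinder r) θ c N ξ
              (EKT.plane c) (r * Real.cos θ) (r * Real.sin θ) M η = 0 ∧
            ∀ u : ℝ → ℝ → ℝ,
              (EKT.dirDeriv u θ c ξ
                - EKT.robinCoeff κ τ (EKT.cylinder r) θ c N ξ
                    (EKT.plane c) (r * Real.cos θ) (r * Real.sin θ) M η * u θ c = 0
                ↔ EKT.dirDeriv u θ c ξ = 0)) ∧
    -- it is a capillary surface with contact angle π / 2
    EKT.IsCapillary κ τ L (Real.pi / 2) (EKT.cylinder r) ∧
    -- it is not stable in the partitioning problem if it is longer than L₀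
    (EKT.criticalLength κ τ ρ < L →
      ¬ EKT.IsStable κ τ L (Real.pi / 2) (EKT.cylinder r)) := by
  have h := EKT.denom_pos hr hdisk
  refine ⟨fun c _ θ N M hN hM => ⟨EKT.metric_unitNormals hr h hN hM, fun ξ η _ hη => ?_⟩,
    EKT.isCapillary_cylinder τ hL hr h, fun hlt => EKT.not_isStable_cylinder τ hL hr h ?_⟩
  · have hq := EKT.robinCoeff_eq_zero hr h hN hM ξ hη
    exact ⟨hq, fun u => by rw [hq, zero_mul, sub_zero]⟩
  -- L₀ is twice the length at which the test family starts to decrease the area.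
  · rw [hρ, EKT.criticalLength_circleRadius hr h] at hlt
    have hs : 0 < EKT.conf κ r := div_pos (by norm_num) h
    have : 0 ≤ Real.pi * (EKT.conf κ r * r) * Real.sqrt (1 + τ ^ 2 * r ^ 2) := by positivity
    linarith
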